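/- Let $R$ be a ring with identity and let $A$ be a chain complex ($\mathbb{Z}$-indexed, differentials lowering degree) of right $R$-modules. For a chain complex $Y$ of left $R$-modules let $A\otimes Y$ be the usual tensor product complex, $(A\otimes Y)_n=\bigoplus_{i+j=n}A_i\otimes_R Y_j$ with boundary $\delta(a\otimes y)=da\otimes y+(-1)^{|a|}a\otimes dy$, and let $A\,\overline{\otimes}\,Y$ be the complex of abelian groups with $(A\,\overline{\otimes}\,Y)_n=(A\otimes Y)_n/B_n(A\otimes Y)$ and differential $\overline{a\otimes y}\mapsto\overline{da\otimes y}$, where $B_n$ denotes boundaries. A double complex is a chain complex $\mathbb{P}=(\mathbb{P}_n)_{n\in\mathbb{Z}}$ in the category $\mathrm{Ch}(R)$ of chain complexes of left $R$-modules; $A\,\overline{\otimes}\,\mathbb{P}$ is the complex of complexes of abelian groups obtained by applying $A\,\overline{\otimes}\,-$ to each $\mathbb{P}_n$ and to the differentials. Call $\mathbb{P}$ an $A$-acyclic complex of projective complexes if each $\mathbb{P}_n$ is a projective object of $\mathrm{Ch}(R)$ and $A\,\overline{\otimes}\,\mathbb{P}$ is exact. The cardinality of a complex $X$ of modules is $|X|=|\coprod_n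 X_n|$ (disjoint union of the underlying sets), and that of a double complex $\mathbb{X}$ is $|\mathbb{X}|=|\coprod_{n,m}(\mathbb{X}_n)_m|$. **Theorem.** Let $\kappa$ be a regular cardinal with $\kappa>\max\{|R|,|A|,\omega\}$, and let $\mathbb{P}$ be a nonzero $A$-acyclic complex of projective complexes. Then there are an ordinal $\lambda$ and subcomplexes $\mathbb{Q}_\alpha\subseteq\mathbb{P}$ $(\alpha<\lambda)$ such that $\mathbb{P}$ is the continuous union $\mathbb{P}=\bigcup_{\alpha<\lambda}\mathbb{Q}_\alpha$, that is, $\mathbb{Q}_\alpha\subseteq\mathbb{Q}_\beta$ for $\alpha\le\beta<\lambda$, $\mathbb{Q}_\gamma=\bigcup_{\alpha<\gamma}\mathbb{Q}_\alpha$ for every limit ordinal $\gamma<\lambda$, and every element of $\mathbb{P}$ lies in some $\mathbb{Q}_\alpha$; and moreover: 1. each $\mathbb{Q}_\alpha$ $(\alpha<\lambda)$ and each quotient $\mathbb{Q}_{\alpha+1}/\mathbb{Q}_\alpha$ $(\alpha+1<\lambda)$ is again an $A$-acyclic complex of projective complexes; 2. $|\mathbb{Q}_{\alpha+1}/\mathbb{Q}_\alpha|<\kappa$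 whenever $\alpha+1<\lambda$, and $|\mathbb{Q}_\alpha|<\kappa$ for every $\alpha<\lambda$ with $\alpha<\kappa$ (in particular $|\mathbb{Q}_0|<\kappa$). -/

import Mathlib

open CategoryTheory
open scoped TensorProduct

universe u

namespace DoubleCx

/-! ### The tensor product of a right module with a left module

`R` is an arbitrary ring; a right `R`-module is a module over `Rᵐᵒᵖ`. -/

section Balanced

variable (R : Type u) [Ring R]

/-- The subgroup of `M ⊗_ℤ N` generated by all `(m r) ⊗ n - m ⊗ (r n)`. -/
def balancedRel (M N : Type u) [AddCommGroup M] [Module Rᵐᵒᵖ M] [AddCommGroup N] [Module R N] :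
    AddSubgroup (M ⊗[ℤ] N) :=
  AddSubgroup.closure {t | ∃ (r : R) (m : M) (n : N),
    t = (MulOpposite.op r • m) ⊗ₜ[ℤ] n - m ⊗ₜ[ℤ] (r • n)}

/-- The abelian group `M ⊗_R N` for a right `R`-module `M` and a left `R`-module `N`. -/
def BalancedTensor (M N : Type u) [AddCommGroup M] [Module Rᵐᵒᵖ M] [AddCommGroup N]
    [Module R N] : Type u :=
  (M ⊗[ℤ] N) ⧸ balancedRel R M N

instance (M N : Type u) [AddCommGroup M] [Module Rᵐᵒᵖ M] [AddCommGroup N] [Module R N] :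
    AddCommGroup (BalancedTensor R M N) :=
  inferInstanceAs (AddCommGroup ((M ⊗[ℤ] N) ⧸ balancedRel R M N))

variable {R}
variable {M M' M'' N N' N'' : Type u}
  [AddCommGroup M] [Module Rᵐᵒᵖ M] [AddCommGroup M'] [Module Rᵐᵒᵖ M']
  [AddCommGroup M''] [Module Rᵐᵒᵖ M'']
  [AddCommGroup N] [Module R N] [AddCommGroup N'] [Module R N'] [AddCommGroup N''] [Module R N'']

/-- The pure tensor `m ⊗ n` in `M ⊗_R N`. -/
def btmul (m : M) (n : N) : BalancedTensor R M N :=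
  QuotientAddGroup.mk' (balancedRel R M N) (m ⊗ₜ[ℤ] n)

/-- The map `f ⊗ g : M ⊗_R N → M' ⊗_R N'`. -/
def btmap (f : M →ₗ[Rᵐᵒᵖ] M') (g : N →ₗ[R] N') :
    BalancedTensor R M N →+ BalancedTensor R M' N' :=
  QuotientAddGroup.map (balancedRel R M N) (balancedRel R M' N')
    (TensorProduct.map f.toAddMonoidHom.toIntLinearMap
      g.toAddMonoidHom.toIntLinearMap).toAddMonoidHom (by
      rw [balancedRel, AddSubgroup.closure_le]
      rintro _ ⟨r, m, n, rfl⟩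
      apply AddSubgroup.subset_closure
      refine ⟨r, f m, g n, ?_⟩
      rw [map_sub, ← map_smul f, ← map_smul g]
      rfl)

@[simp]
theorem btmap_btmul (f : M →ₗ[Rᵐᵒᵖ] M') (g : N →ₗ[R] N') (m : M) (n : N) :
    btmap f g (btmul m n) = btmul (f m) (g n) := rfl

theorem bt_hom_ext {G : Type*} [AddCommGroup G] {f g : BalancedTensor R M N →+ G}
    (h : ∀ m n, f (btmul m n) = g (btmul m n)) : f = g := by
  apply QuotientAddGroup.addMonoidHom_ext
  ext t
  induction t using TensorProduct.induction_on with
  | zero => simp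
  | tmul m n => exact h m n
  | add x y hx hy => rw [map_add, map_add, hx, hy]

theorem btmul_zero (m : M) : (btmul m 0 : BalancedTensor R M N) = 0 := by
  rw [btmul, TensorProduct.tmul_zero]; rfl

theorem zero_btmul (n : N) : (btmul 0 n : BalancedTensor R M N) = 0 := by
  rw [btmul, TensorProduct.zero_tmul]; rfl

theorem btmul_add (m : M) (n n' : N) :
    (btmul m (n + n') : BalancedTensor R M N) = btmul m n + btmul m n' := by
  rw [btmul, TensorProduct.tmul_add]; rfl

end Balanced

/-! ### The usual tensor product of complexes, and the modified one -/

section Complexes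

variable {R : Type u} [Ring R]
variable (X : ChainComplex (ModuleCat.{u} Rᵐᵒᵖ) ℤ) (Y : ChainComplex (ModuleCat.{u} R) ℤ)

/-- `(X ⊗ Y)_n = ⨁_{i + j = n} X_i ⊗_R Y_j`. -/
abbrev Tot (n : ℤ) : Type u :=
  DirectSum {p : ℤ × ℤ // p.1 + p.2 = n} fun p => BalancedTensor R (X.X p.1.1) (Y.X p.1.2)

/-- The inclusion of the summand `X_i ⊗_R Y_j` in `(X ⊗ Y)_n`. -/
def incl (n i j : ℤ) (h : i + j = n) : BalancedTensor R (X.X i) (Y.X j) →+ Tot X Y n :=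
  DirectSum.of (fun p : {p : ℤ × ℤ // p.1 + p.2 = n} =>
    BalancedTensor R (X.X p.1.1) (Y.X p.1.2)) ⟨(i, j), h⟩

/-- The map `(X ⊗ Y)_n → (X ⊗ Y)_{n'}` with `x ⊗ y ↦ dx ⊗ y`. Here `d` is the differential of `X`
from degree `i` to degree `i + (n' - n)`; as usual it is `0` unless `n' = n - 1`. -/
def dLeft (n n' : ℤ) : Tot X Y n →+ Tot X Y n' :=
  DirectSum.toAddMonoid fun p =>
    (incl X Y n' (p.1.1 + (n' - n)) p.1.2 (by have := p.2; omega)).comp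
      (btmap (X.d p.1.1 (p.1.1 + (n' - n))).hom LinearMap.id)

/-- The map `(X ⊗ Y)_n → (X ⊗ Y)_{n'}` with `x ⊗ y ↦ (-1)^|x| x ⊗ dy`; it is `0` unless
`n' = n - 1`. -/
def dRight (n n' : ℤ) : Tot X Y n →+ Tot X Y n' :=
  DirectSum.toAddMonoid fun p =>
    ((p.1.1.negOnePow : ℤˣ) : ℤ) •
      (incl X Y n' p.1.1 (p.1.2 + (n' - n)) (by have := p.2; omega)).comp
        (btmap LinearMap.id (Y.d p.1.2 (p.1.2 + (n' - n))).hom)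

/-- The boundary map of `X ⊗ Y`: `δ (x ⊗ y) = dx ⊗ y + (-1)^|x| x ⊗ dy`. -/
def delta (n n' : ℤ) : Tot X Y n →+ Tot X Y n' := dLeft X Y n n' + dRight X Y n n'

/-- The boundaries `B_n (X ⊗ Y)`. -/
def boundaries (n : ℤ) : AddSubgroup (Tot X Y n) := (delta X Y (n + 1) n).range

variable {X Y}

theorem tot_hom_ext {n : ℤ} {G : Type*} [AddCommGroup G] {f g : Tot X Y n →+ G}
    (h : ∀ (i j : ℤ) (hij : i + j = n) (x : X.X i) (y : Y.X j),
      f (incl X Y n i j hij (btmul x y)) = g (incl X Y n i j hij (btmul x y))) : f = g := by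
  apply DirectSum.addHom_ext'
  rintro ⟨⟨i, j⟩, hij⟩
  exact bt_hom_ext (h i j hij)

theorem dLeft_incl (n n' i j : ℤ) (h : i + j = n) (x : X.X i) (y : Y.X j) :
    dLeft X Y n n' (incl X Y n i j h (btmul x y)) =
      incl X Y n' (i + (n' - n)) j (by omega) (btmul ((X.d i (i + (n' - n))).hom x) y) := by
  rw [dLeft, incl, DirectSum.toAddMonoid_of]
  rfl

theorem dRight_incl (n n' i j : ℤ) (h : i + j = n) (x : X.X i) (y : Y.X j) :
    dRight X Y n n' (incl X Y n i j h (btmul x y)) =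
      ((i.negOnePow : ℤˣ) : ℤ) •
        incl X Y n' i (j + (n' - n)) (by omega) (btmul x ((Y.d j (j + (n' - n))).hom y)) := by
  rw [dRight, incl, DirectSum.toAddMonoid_of]
  rfl

theorem dLeft_dLeft (n n' n'' : ℤ) (z : Tot X Y n) :
    dLeft X Y n' n'' (dLeft X Y n n' z) = 0 := by
  suffices h : (dLeft X Y n' n'').comp (dLeft X Y n n') = 0 from DFunLike.congr_fun h z
  apply tot_hom_ext
  intro i j h x y
  rw [AddMonoidHom.comp_apply, dLeft_incl, dLeft_incl, ← LinearMap.comp_apply, ← ModuleCat.hom_comp,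
    X.d_comp_d, ModuleCat.hom_zero, LinearMap.zero_apply, zero_btmul, map_zero]
  rfl

theorem dLeft_shape (n n' : ℤ) (h : n' + 1 ≠ n) : dLeft X Y n n' = 0 := by
  apply tot_hom_ext
  intro i j hij x y
  rw [dLeft_incl, X.shape _ _ (by simp only [ComplexShape.down_Rel]; omega), ModuleCat.hom_zero,
    LinearMap.zero_apply, zero_btmul, map_zero]
  rfl

theorem dLeft_dRight (n : ℤ) (z : Tot X Y (n + 1)) :
    dLeft X Y n (n - 1) (dRight X Y (n + 1) n z) =
      - dRight X Y n (n - 1) (dLeft X Y (n + 1) n z) := by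
  suffices h : (dLeft X Y n (n - 1)).comp (dRight X Y (n + 1) n) =
      - (dRight X Y n (n - 1)).comp (dLeft X Y (n + 1) n) from DFunLike.congr_fun h z
  apply tot_hom_ext
  intro i j h x y
  rw [AddMonoidHom.neg_apply, AddMonoidHom.comp_apply, AddMonoidHom.comp_apply,
    dRight_incl, map_zsmul, dLeft_incl, dLeft_incl, dRight_incl, ← neg_smul]
  have h1 : n - (n + 1) = -1 := by ring
  have h3 : -(((i + (n - (n + 1))).negOnePow : ℤˣ) : ℤ) = ((i.negOnePow : ℤˣ) : ℤ) := by
    rw [h1, ← sub_eq_add_neg, Int.negOnePow_sub]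
    simp
  rw [h3]
  have key : ∀ a b : ℤ, a = b → ∀ (h : i + a + (j + b) = n - 1),
      incl X Y (n - 1) (i + a) (j + b) h (btmul ((X.d i (i + a)).hom x)
        ((Y.d j (j + b)).hom y)) =
      incl X Y (n - 1) (i + b) (j + a) (by omega) (btmul ((X.d i (i + b)).hom x)
        ((Y.d j (j + a)).hom y)) := by
    rintro a b rfl h
    rfl
  rw [key _ _ (by omega)]

/-- On `X ⊗ Y` the map `x ⊗ y ↦ dx ⊗ y` anticommutes with the boundary map. -/
theorem dLeft_delta (n : ℤ) (z : Tot X Y (n + 1)) :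
    dLeft X Y n (n - 1) (delta X Y (n + 1) n z) =
      - delta X Y n (n - 1) (dLeft X Y (n + 1) n z) := by
  rw [delta, delta, AddMonoidHom.add_apply, AddMonoidHom.add_apply, map_add, dLeft_dLeft,
    dLeft_dRight, zero_add, zero_add]

theorem dLeft_boundaries (n n' : ℤ) :
    boundaries X Y n ≤ (boundaries X Y n').comap (dLeft X Y n n') := by
  by_cases h : n' + 1 = n
  · obtain rfl : n' = n - 1 := by omega
    rintro _ ⟨z, rfl⟩
    rw [AddSubgroup.mem_comap, dLeft_delta]
    apply AddSubgroup.neg_mem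
    have key : ∀ a : ℤ, a = n → ∀ w : Tot X Y n, delta X Y n (n - 1) w ∈
        (delta X Y a (n - 1)).range := by
      rintro a rfl w
      exact ⟨w, rfl⟩
    exact key _ (by omega) _
  · rw [dLeft_shape n n' h]
    intro z _
    exact (boundaries X Y n').zero_mem

variable (X Y)

/-- The modified tensor product `X ⊗̄ Y`: it has `(X ⊗ Y)_n / B_n (X ⊗ Y)` in degree `n`, and its
differential is induced by `x ⊗ y ↦ dx ⊗ y`. -/
def barObj : ChainComplex AddCommGrpCat.{u} ℤ where
  X n := AddCommGrpCat.of (Tot X Y n ⧸ boundaries X Y n)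
  d n n' := AddCommGrpCat.ofHom
    (QuotientAddGroup.map (boundaries X Y n) (boundaries X Y n') (dLeft X Y n n')
      (dLeft_boundaries n n'))
  shape n n' h := by
    ext1
    apply QuotientAddGroup.addMonoidHom_ext
    refine AddMonoidHom.ext fun z => ?_
    change QuotientAddGroup.mk (dLeft X Y n n' z) = 0
    rw [dLeft_shape n n' h]
    rfl
  d_comp_d' n n' n'' _ _ := by
    ext1
    apply QuotientAddGroup.addMonoidHom_ext
    refine AddMonoidHom.ext fun z => ?_
    change QuotientAddGroup.mk (dLeft X Y n' n'' (dLeft X Y n n' z)) = 0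
    rw [dLeft_dLeft]
    rfl

variable {Y} {Y' Y'' : ChainComplex (ModuleCat.{u} R) ℤ}

/-- The map `X ⊗ f` in degree `n`, that is `x ⊗ y ↦ x ⊗ f y`. -/
def totMap (f : Y ⟶ Y') (n : ℤ) : Tot X Y n →+ Tot X Y' n :=
  DirectSum.toAddMonoid fun p =>
    (incl X Y' n p.1.1 p.1.2 p.2).comp (btmap LinearMap.id (f.f p.1.2).hom)

variable {X}

theorem totMap_incl (f : Y ⟶ Y') (n i j : ℤ) (h : i + j = n) (x : X.X i) (y : Y.X j) :
    totMap X f n (incl X Y n i j h (btmul x y)) =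
      incl X Y' n i j h (btmul x ((f.f j).hom y)) := by
  rw [totMap, incl, DirectSum.toAddMonoid_of]
  rfl

theorem totMap_id (n : ℤ) : totMap X (𝟙 Y) n = AddMonoidHom.id _ := by
  apply tot_hom_ext
  intro i j h x y
  rw [totMap_incl]
  rfl

theorem totMap_comp (f : Y ⟶ Y') (g : Y' ⟶ Y'') (n : ℤ) :
    totMap X (f ≫ g) n = (totMap X g n).comp (totMap X f n) := by
  apply tot_hom_ext
  intro i j h x y
  rw [AddMonoidHom.comp_apply, totMap_incl, totMap_incl, totMap_incl]
  rfl

theorem totMap_add (f g : Y ⟶ Y') (n : ℤ) :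
    totMap X (f + g) n = totMap X f n + totMap X g n := by
  apply tot_hom_ext
  intro i j h x y
  rw [AddMonoidHom.add_apply, totMap_incl, totMap_incl, totMap_incl, ← map_add, ← btmul_add]
  rfl

theorem totMap_dLeft (f : Y ⟶ Y') (n n' : ℤ) (z : Tot X Y n) :
    totMap X f n' (dLeft X Y n n' z) = dLeft X Y' n n' (totMap X f n z) := by
  suffices h : (totMap X f n').comp (dLeft X Y n n') = (dLeft X Y' n n').comp (totMap X f n) from
    DFunLike.congr_fun h z
  apply tot_hom_ext
  intro i j h x y
  rw [AddMonoidHom.comp_apply, AddMonoidHom.comp_apply, totMap_incl, dLeft_incl, dLeft_incl,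
    totMap_incl]

theorem totMap_dRight (f : Y ⟶ Y') (n n' : ℤ) (z : Tot X Y n) :
    totMap X f n' (dRight X Y n n' z) = dRight X Y' n n' (totMap X f n z) := by
  suffices h : (totMap X f n').comp (dRight X Y n n') = (dRight X Y' n n').comp (totMap X f n) from
    DFunLike.congr_fun h z
  apply tot_hom_ext
  intro i j h x y
  rw [AddMonoidHom.comp_apply, AddMonoidHom.comp_apply, totMap_incl, dRight_incl, dRight_incl,
    map_zsmul, totMap_incl, ← LinearMap.comp_apply, ← LinearMap.comp_apply, ← ModuleCat.hom_comp,
    ← ModuleCat.hom_comp, f.comm]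

theorem totMap_boundaries (f : Y ⟶ Y') (n : ℤ) :
    boundaries X Y n ≤ (boundaries X Y' n).comap (totMap X f n) := by
  rintro _ ⟨z, rfl⟩
  refine ⟨totMap X f (n + 1) z, ?_⟩
  rw [delta, delta, AddMonoidHom.add_apply, AddMonoidHom.add_apply, map_add, totMap_dLeft,
    totMap_dRight]

variable (X)

/-- The functor `X ⊗̄ -`. -/
def barTensor : ChainComplex (ModuleCat.{u} R) ℤ ⥤ ChainComplex AddCommGrpCat.{u} ℤ where
  obj Y := barObj X Y
  map {Y Y'} f :=
    { f := fun n => AddCommGrpCat.ofHom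
        (QuotientAddGroup.map (boundaries X Y n) (boundaries X Y' n) (totMap X f n)
          (totMap_boundaries f n))
      comm' := fun n n' _ => by
        ext1
        apply QuotientAddGroup.addMonoidHom_ext
        refine AddMonoidHom.ext fun z => ?_
        change QuotientAddGroup.mk (dLeft X Y' n n' (totMap X f n z)) =
          QuotientAddGroup.mk (totMap X f n' (dLeft X Y n n' z))
        rw [totMap_dLeft] }
  map_id Y := by
    ext n : 2
    apply QuotientAddGroup.addMonoidHom_ext
    refine AddMonoidHom.ext fun z => ?_
    change QuotientAddGroup.mk (totMap X (𝟙 Y) n z) = QuotientAddGroup.mk z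
    rw [totMap_id]
    rfl
  map_comp {Y Y' Y''} f g := by
    ext n : 2
    apply QuotientAddGroup.addMonoidHom_ext
    refine AddMonoidHom.ext fun z => ?_
    change QuotientAddGroup.mk (totMap X (f ≫ g) n z) =
      QuotientAddGroup.mk (totMap X g n (totMap X f n z))
    rw [totMap_comp]
    rfl

instance : (barTensor X).Additive where
  map_add {Y Y' f g} := by
    ext n : 2
    apply QuotientAddGroup.addMonoidHom_ext
    refine AddMonoidHom.ext fun z => ?_
    change QuotientAddGroup.mk (totMap X (f + g) n z) =
      QuotientAddGroup.mk (totMap X f n z + totMap X g n z)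
    rw [totMap_add]
    rfl

end Complexes

/-! ### Double complexes, subcomplexes, quotients, cardinality -/

section Double

variable {R : Type u} [Ring R]

variable (R) in
/-- The category `Ch(Ch(R))` of complexes of complexes of left `R`-modules. -/
abbrev DoubleComplex := ChainComplex (ChainComplex (ModuleCat.{u} R) ℤ) ℤ

/-- The complex of complexes `A ⊗̄ P`, obtained by applying `A ⊗̄ -` to each `P_n`. -/
noncomputable abbrev tensorDouble (A : ChainComplex (ModuleCat.{u} Rᵐᵒᵖ) ℤ)
    (P : DoubleComplex R) : ChainComplex (ChainComplex AddCommGrpCat.{u} ℤ) ℤ :=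
  ((barTensor A).mapHomologicalComplex (ComplexShape.down ℤ)).obj P

/-- `P` is an `A`-acyclic complex of projective complexes: each `P_n` is a projective object of
`Ch(R)`, and `A ⊗̄ P` is exact. -/
structure IsAcyclicOfProjectives (A : ChainComplex (ModuleCat.{u} Rᵐᵒᵖ) ℤ)
    (P : DoubleComplex R) : Prop where
  projective : ∀ n, Projective (P.X n)
  exact : (tensorDouble A P).Acyclic

/-- The cardinality of a complex of modules: the cardinality of the disjoint union of its
components. -/
noncomputable def card {S : Type u} [Ring S] (X : ChainComplex (ModuleCat.{u} S) ℤ) :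
    Cardinal.{u} :=
  Cardinal.mk (Σ n : ℤ, X.X n)

/-- The cardinality of a double complex. -/
noncomputable def cardDouble (P : DoubleComplex R) : Cardinal.{u} :=
  Cardinal.mk (Σ n : ℤ, Σ m : ℤ, (P.X n).X m)

/-- A subcomplex of a double complex: submodules `Q_{n,m} ⊆ P_{n,m}` such that every `Q_n` is a
subcomplex of `P_n`, and the differential of `P` maps `Q_n` to `Q_{n-1}`. -/
structure Subcomplex (P : DoubleComplex R) where
  carrier : ∀ n m : ℤ, Submodule R ((P.X n).X m)
  inner_mem : ∀ n m m' : ℤ, carrier n m ≤ (carrier n m').comap ((P.X n).d m m').hom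
  outer_mem : ∀ n n' m : ℤ, carrier n m ≤ (carrier n' m).comap ((P.d n n').f m).hom

namespace Subcomplex

variable {P : DoubleComplex R}

/-- A subcomplex, as a double complex in its own right. -/
def toDouble (Q : Subcomplex P) : DoubleComplex R where
  X n :=
    { X := fun m => ModuleCat.of R (Q.carrier n m)
      d := fun m m' => ModuleCat.ofHom (((P.X n).d m m').hom.restrict (Q.inner_mem n m m'))
      shape := fun m m' h => by
        ext x
        change ((P.X n).d m m').hom x.1 = 0
        rw [(P.X n).shape m m' h]
        rfl
      d_comp_d' := fun m m' m'' _ _ => by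
        ext x
        change (((P.X n).d m m') ≫ ((P.X n).d m' m'')).hom x.1 = 0
        rw [(P.X n).d_comp_d]
        rfl }
  d n n' :=
    { f := fun m => ModuleCat.ofHom (((P.d n n').f m).hom.restrict (Q.outer_mem n n' m))
      comm' := fun m m' _ => by
        ext x
        change ((P.d n n').f m ≫ (P.X n').d m m').hom x.1 =
          ((P.X n).d m m' ≫ (P.d n n').f m').hom x.1
        rw [(P.d n n').comm] }
  shape n n' h := by
    ext m x
    change ((P.d n n').f m).hom x.1 = 0
    rw [P.shape n n' h]
    rfl
  d_comp_d' n n' n'' _ _ := by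
    ext m x
    change ((P.d n n' ≫ P.d n' n'').f m).hom x.1 = 0
    rw [P.d_comp_d]
    rfl

/-- The submodule `Q_{n,m}` of `Q'_{n,m}` (in general, `Q_{n,m} ∩ Q'_{n,m}`). -/
abbrev inside (Q' Q : Subcomplex P) (n m : ℤ) : Submodule R (Q'.carrier n m) :=
  (Q.carrier n m).submoduleOf (Q'.carrier n m)

/-- The quotient `Q' / Q`, for subcomplexes `Q ⊆ Q'` of a double complex. -/
def quotient (Q' Q : Subcomplex P) : DoubleComplex R where
  X n :=
    { X := fun m => ModuleCat.of R (Q'.carrier n m ⧸ inside Q' Q n m)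
      d := fun m m' => ModuleCat.ofHom (Submodule.mapQ (inside Q' Q n m) (inside Q' Q n m')
        (((P.X n).d m m').hom.restrict (Q'.inner_mem n m m')) (fun x hx => Q.inner_mem n m m' hx))
      shape := fun m m' h => by
        ext1
        apply Submodule.linearMap_qext
        ext x
        change Submodule.Quotient.mk _ = Submodule.Quotient.mk 0
        congr 1
        apply Subtype.ext
        change ((P.X n).d m m').hom x.1 = 0
        rw [(P.X n).shape m m' h]
        rfl
      d_comp_d' := fun m m' m'' _ _ => by
        ext1
        apply Submodule.linearMap_qext
        ext x
        change Submodule.Quotient.mk _ = Submodule.Quotient.mk 0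
        congr 1
        apply Subtype.ext
        change (((P.X n).d m m') ≫ ((P.X n).d m' m'')).hom x.1 = 0
        rw [(P.X n).d_comp_d]
        rfl }
  d n n' :=
    { f := fun m => ModuleCat.ofHom (Submodule.mapQ (inside Q' Q n m) (inside Q' Q n' m)
        (((P.d n n').f m).hom.restrict (Q'.outer_mem n n' m)) (fun x hx => Q.outer_mem n n' m hx))
      comm' := fun m m' _ => by
        ext1
        apply Submodule.linearMap_qext
        ext x
        change Submodule.Quotient.mk _ = Submodule.Quotient.mk _
        congr 1
        apply Subtype.ext
        change ((P.d n n').f m ≫ (P.X n').d m m').hom x.1 =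
          ((P.X n).d m m' ≫ (P.d n n').f m').hom x.1
        rw [(P.d n n').comm] }
  shape n n' h := by
    ext m : 2
    apply Submodule.linearMap_qext
    ext x
    change Submodule.Quotient.mk _ = Submodule.Quotient.mk 0
    congr 1
    apply Subtype.ext
    change ((P.d n n').f m).hom x.1 = 0
    rw [P.shape n n' h]
    rfl
  d_comp_d' n n' n'' _ _ := by
    ext m : 2
    apply Submodule.linearMap_qext
    ext x
    change Submodule.Quotient.mk _ = Submodule.Quotient.mk 0
    congr 1
    apply Subtype.ext
    change ((P.d n n' ≫ P.d n' n'').f m).hom x.1 = 0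
    rw [P.d_comp_d]
    rfl

/-- `P` is the continuous union of the subcomplexes `Q_α`, `α < lam`: they form an increasing
chain, `Q_γ` is the union of the `Q_α` with `α < γ` for each limit ordinal `γ < lam`, and `P` is the
union of all the `Q_α` with `α < lam`. Values `Q_α` with `α ≥ lam` are irrelevant. -/
structure IsContinuousUnion (lam : Ordinal.{u}) (Q : Ordinal.{u} → Subcomplex P) : Prop where
  mono : ∀ α β, α ≤ β → β < lam → ∀ n m, (Q α).carrier n m ≤ (Q β).carrier n m
  limit : ∀ γ, γ < lam → Order.IsSuccLimit γ → ∀ n m x,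
    x ∈ (Q γ).carrier n m ↔ ∃ α < γ, x ∈ (Q α).carrier n m
  exhaust : ∀ n m (x : (P.X n).X m), ∃ α < lam, x ∈ (Q α).carrier n m

end Subcomplex

end Double

end DoubleCx

/-! A projective complex is a direct summand of a sum of disk complexes on free modules. It
therefore has a contracting homotopy that factors through free modules, and these may be taken on
its own elements (`exists_freeContraction`). Conversely, a contraction that factors through
projective modules forces projectivity (`projective_of_contraction`). Fix such a contraction on
every `P_n` and call a subcomplex stable if the contraction of each of its elements involves only
basis elements from the subcomplex. For stable `Q ⊆ Q'` the contractions descend to `Q' / Q`, whose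
outer components are therefore projective (`Stable.projective_quotient`). Projectivity thus becomes
a closure condition in which each element demands only countably many others.

Sequences of quotients of stable subcomplexes split in each outer degree, so they stay exact under
`A ⊗̄ -` and yield long exact homology sequences. In particular, if `A ⊗̄ P` and `A ⊗̄ Q` are exact,
so is `A ⊗̄ (P / Q)`. An element of a tensor product involves finitely many elements of the factors.
Since `κ` is regular, uncountable and larger than `R` and `A`, a set of fewer than `κ` elements of
`P / Q` can be closed under the module operations, the differentials, the contractions and the
choice of preimages of cycles, and still have fewer than `κ` elements (`exists_small_exact`). Its
preimage in `P` is the next subcomplex (`Stable.exists_step`).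

The filtration iterates this step from `0`, absorbing the elements of `P` one at a time along a
well-order and taking unions at limits. Exactness survives limits because each tensor already lives
at some earlier stage (`acyclic_sup`). -/

namespace DoubleCx

/-! ### Cardinal estimates and closing-off of small sets -/

section Cardinals

open Cardinal

theorem mk_iUnion_lt_of_isRegular {α : Type u} {κ : Cardinal.{u}} (hκ : κ.IsRegular) {ι : Type u}
    (hι : #ι < κ) {s : ι → Set α} (hs : ∀ i, #(s i) < κ) : #(⋃ i, s i) < κ :=
  mk_iUnion_le_sum_mk.trans_lt (sum_lt_of_isRegular hκ hι hs)

theorem mk_iUnion_lt_of_countable {α : Type u} {κ : Cardinal.{u}} (hκ : κ.IsRegular)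
    (hω : ℵ₀ < κ) {ι : Type} [Countable ι] {s : ι → Set α} (hs : ∀ i, #(s i) < κ) :
    #(⋃ i, s i) < κ := by
  have h : ⋃ i, s i = ⋃ i : ULift.{u} ι, s i.down := by
    ext x; simp
  rw [h]
  exact mk_iUnion_lt_of_isRegular hκ ((mk_le_aleph0 (α := ULift.{u} ι)).trans_lt hω)
    fun i => hs i.down

theorem mk_union_lt {α : Type u} {κ : Cardinal.{u}} (hω : ℵ₀ ≤ κ) {s t : Set α}
    (hs : #s < κ) (ht : #t < κ) : #(s ∪ t : Set α) < κ :=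
  (mk_union_le s t).trans_lt (add_lt_of_lt hω hs ht)

theorem mk_finset_lt {α : Type u} {κ : Cardinal.{u}} (hω : ℵ₀ < κ) (h : #α < κ) :
    #(Finset α) < κ := by
  cases finite_or_infinite α
  · exact (lt_aleph0_of_finite _).trans hω
  · rwa [mk_finset_of_infinite]

/-- A small set can be enlarged to a small set that is closed under a given finitary operation
with small values. -/
theorem exists_small_closed {B : Type u} {κ : Cardinal.{u}} (hκ : κ.IsRegular) (hω : ℵ₀ < κ)
    (Φ : Finset B → Set B) (hΦ : ∀ F, #(Φ F) < κ) (s : Set B) (hs : #s < κ) :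
    ∃ t : Set B, s ⊆ t ∧ #t < κ ∧ ∀ F : Finset B, ↑F ⊆ t → Φ F ⊆ t := by
  classical
  -- A set of size `< κ` has `< κ` finite subsets, so one round of adjoining values stays small by
  -- regularity. Countably many rounds suffice: a finite subset of the union lies in a single round,
  -- and its values are adjoined in the next.
  let next : Set B → Set B := fun t =>
    t ∪ ⋃ F : Finset t, Φ (F.map (Function.Embedding.subtype _))
  have hnext : ∀ t : Set B, #t < κ → #(next t) < κ := fun t ht =>
    mk_union_lt hω.le ht (mk_iUnion_lt_of_isRegular hκ (mk_finset_lt hω ht) fun F => hΦ _)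
  let u : ℕ → Set B := fun n => next^[n] s
  have hu : ∀ n, u (n + 1) = next (u n) := fun n => Function.iterate_succ_apply' _ _ _
  have hmono : Monotone u := monotone_nat_of_le_succ fun n => by
    rw [hu]; exact Set.subset_union_left
  refine ⟨⋃ n, u n, Set.subset_iUnion u 0, ?_, ?_⟩
  · refine mk_iUnion_lt_of_countable hκ hω fun n => ?_
    induction n with
    | zero => exact hs
    | succ n ih => rw [hu]; exact hnext _ ih
  · intro F hF
    obtain ⟨n, hn⟩ : ∃ n, ↑F ⊆ u n := hmono.directed_le.exists_mem_subset_of_finset_subset_biUnion hF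
    refine Set.Subset.trans ?_ (Set.subset_iUnion u (n + 1))
    rw [hu]
    refine Set.Subset.trans ?_ Set.subset_union_right
    refine Set.subset_iUnion_of_subset (F.subtype (· ∈ u n)) ?_
    rw [Finset.subtype_map_of_mem hn]

theorem mk_span_lt {S M : Type u} [Ring S] [AddCommGroup M] [Module S M] {κ : Cardinal.{u}}
    (hω : ℵ₀ < κ) (hS : #S < κ) {s : Set M} (hs : #s < κ) : #(Submodule.span S s) < κ := by
  -- A finitely supported function is determined by its graph, a finite subset of `s × S`; the span
  -- is an image of the set of such functions.
  have h : #(s →₀ S) < κ := by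
    refine (mk_le_of_injective (f := fun f : s →₀ S => f.graph)
      (Finsupp.graph_injective _ _)).trans_lt (mk_finset_lt hω ?_)
    rw [mk_prod, lift_id, lift_id]
    exact mul_lt_of_lt hω.le hs hS
  have h' := congrArg SetLike.coe (Finsupp.range_linearCombination S (v := ((↑) : s → M)))
  rw [Subtype.range_coe] at h'
  refine lt_of_le_of_lt ?_ h
  change #(Submodule.span S s : Set M) ≤ _
  rw [← h', LinearMap.coe_range]
  exact mk_range_le

/-- The subgroup is contained in the span over the integers, lifted to universe `u` to serve as the
ring `S` of `mk_span_lt`. -/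
theorem mk_addSubgroup_closure_lt {M : Type u} [AddCommGroup M] {κ : Cardinal.{u}}
    (hω : ℵ₀ < κ) {s : Set M} (hs : #s < κ) : #(AddSubgroup.closure s) < κ := by
  have h := mk_span_lt (S := ULift.{u} ℤ) hω ((mk_le_aleph0 (α := ULift.{u} ℤ)).trans_lt hω) hs
  refine lt_of_le_of_lt (mk_le_mk_of_subset ?_) h
  change (AddSubgroup.closure s : Set M) ⊆ (Submodule.span (ULift.{u} ℤ) s).toAddSubgroup
  exact (AddSubgroup.closure_le _).2 Submodule.subset_span

end Cardinals

end DoubleCx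

namespace DoubleCx

/-! ### Projective complexes and contractions through free modules -/

section Contraction

variable {R : Type u} [Ring R]

/-- The canonical map from the free module on the elements of a module to the module. -/
noncomputable abbrev freeEval (M : Type u) [AddCommGroup M] [Module R M] : (M →₀ R) →ₗ[R] M :=
  Finsupp.linearCombination R id

/-- A contracting homotopy of `Y` whose components factor through the free modules on the elements
of `Y`. -/
structure FreeContraction (Y : ChainComplex (ModuleCat.{u} R) ℤ) where
  map : ∀ i j : ℤ, Y.X i →ₗ[R] (Y.X j →₀ R)
  map_eq : ∀ k i j : ℤ, k + 1 = i → i + 1 = j → ∀ y : Y.X i,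
    freeEval (Y.X i) (map k i ((Y.d i k).hom y)) +
      (Y.d j i).hom (freeEval (Y.X j) (map i j y)) = y

/-- Lifting degreewise through the modules `G i` gives maps `φ` that need not be compatible with the
differentials. Using `φ ∘ b` as a homotopy repairs this: the associated null-homotopic map is a
chain map for free, and `e` carries it to `f` composed with `(c b) d + d (c b) = 1`. -/
theorem projective_of_contraction (Z : ChainComplex (ModuleCat.{u} R) ℤ) (G : ℤ → Type u)
    [∀ i, AddCommGroup (G i)] [∀ i, Module R (G i)] [∀ i, Module.Projective R (G i)]
    (b : ∀ i j : ℤ, Z.X i →ₗ[R] G j) (c : ∀ i, G i →ₗ[R] Z.X i)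
    (h : ∀ k i j : ℤ, k + 1 = i → i + 1 = j → ∀ z : Z.X i,
      c i (b k i ((Z.d i k).hom z)) + (Z.d j i).hom (c j (b i j z)) = z) : Projective Z where
  factors {E X} f e _ := by
    have he : ∀ i, Function.Surjective (e.f i).hom := fun i =>
      (ModuleCat.epi_iff_surjective _).1 inferInstance
    choose φ hφ using fun i => Module.projective_lifting_property (e.f i).hom ((f.f i).hom ∘ₗ c i)
      (he i)
    have hφ' : ∀ i x, (e.f i).hom (φ i x) = (f.f i).hom (c i x) := fun i x =>
      LinearMap.congr_fun (hφ i) x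
    have hd : ∀ (W : ChainComplex (ModuleCat.{u} R) ℤ) (i j k : ℤ) (x : W.X i),
        (W.d j k).hom ((W.d i j).hom x) = 0 := fun W i j k x => by
      rw [← LinearMap.comp_apply, ← ModuleCat.hom_comp, W.d_comp_d]; rfl
    have hc : ∀ {W V : ChainComplex (ModuleCat.{u} R) ℤ} (g : W ⟶ V) (i j : ℤ) (x : W.X i),
        (g.f j).hom ((W.d i j).hom x) = (V.d i j).hom ((g.f i).hom x) := fun g i j x => by
      rw [← LinearMap.comp_apply, ← LinearMap.comp_apply, ← ModuleCat.hom_comp,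
        ← ModuleCat.hom_comp, g.comm]
    let F : ∀ i, Z.X i →ₗ[R] E.X i := fun i =>
      φ i ∘ₗ b (i - 1) i ∘ₗ (Z.d i (i - 1)).hom + (E.d (i + 1) i).hom ∘ₗ φ (i + 1) ∘ₗ b i (i + 1)
    have hF : ∀ i z, F i z = φ i (b (i - 1) i ((Z.d i (i - 1)).hom z)) +
      (E.d (i + 1) i).hom (φ (i + 1) (b i (i + 1) z)) := fun i z => rfl
    refine ⟨{ f := fun i => ModuleCat.ofHom (F i), comm' := fun i j hij => ?_ }, ?_⟩
    · obtain rfl : j + 1 = i := hij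
      ext z
      change (E.d (j + 1) j).hom (F (j + 1) z) = F j ((Z.d (j + 1) j).hom z)
      rw [hF, hF, map_add, hd, hd, map_zero, map_zero, add_zero, zero_add]
      -- The degrees `j + 1 - 1` and `j` are equal but not definitionally so.
      have : ∀ k, k = j → φ (j + 1) (b k (j + 1) ((Z.d (j + 1) k).hom z)) =
          φ (j + 1) (b j (j + 1) ((Z.d (j + 1) j).hom z)) := by rintro _ rfl; rfl
      rw [this (j + 1 - 1) (by omega)]
    · ext i z
      change (e.f i).hom (F i z) = (f.f i).hom z
      rw [hF, map_add, hφ', hc, hφ', ← hc, ← map_add, h _ _ _ (by omega) rfl]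

/-- The transport of free modules along an equality of degrees. -/
noncomputable def freeCast (Y : ChainComplex (ModuleCat.{u} R) ℤ) {i j : ℤ} (h : i = j) :
    (Y.X i →₀ R) →ₗ[R] (Y.X j →₀ R) := by
  subst h; exact LinearMap.id

/-- The free contractible complex which is the sum of the disk complexes on the elements of `Y`. -/
noncomputable def freeDisks (Y : ChainComplex (ModuleCat.{u} R) ℤ) :
    ChainComplex (ModuleCat.{u} R) ℤ where
  X i := ModuleCat.of R ((Y.X i →₀ R) × (Y.X (i + 1) →₀ R))
  d i j := if h : i = j + 1 then
    ModuleCat.ofHom (LinearMap.inr R (Y.X j →₀ R) (Y.X (j + 1) →₀ R) ∘ₗ freeCast Y h ∘ₗ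
      LinearMap.fst R (Y.X i →₀ R) (Y.X (i + 1) →₀ R)) else 0
  shape i j h := dif_neg fun h' => h h'.symm
  d_comp_d' i j k hij hjk := by
    rw [dif_pos hij.symm, dif_pos hjk.symm]
    ext1
    refine LinearMap.ext fun x => ?_
    change (0, freeCast Y hjk.symm 0) = (0 : (Y.X k →₀ R) × (Y.X (k + 1) →₀ R))
    rw [map_zero]
    rfl

theorem freeDisks_d (Y : ChainComplex (ModuleCat.{u} R) ℤ) (j : ℤ)
    (x : (Y.X (j + 1) →₀ R) × (Y.X (j + 1 + 1) →₀ R)) :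
    ((freeDisks Y).d (j + 1) j).hom x = ((0, x.1) : (Y.X j →₀ R) × (Y.X (j + 1) →₀ R)) := by
  simp only [freeDisks]
  rw [dif_pos trivial]
  rfl

/-- The canonical map onto `Y` from a sum of disk complexes. -/
noncomputable def freeDisksEval (Y : ChainComplex (ModuleCat.{u} R) ℤ) : freeDisks Y ⟶ Y where
  f i := ModuleCat.ofHom ((freeEval (Y.X i)).coprod
    ((Y.d (i + 1) i).hom ∘ₗ freeEval (Y.X (i + 1))))
  comm' i j hij := by
    obtain rfl : j + 1 = i := hij
    ext1
    refine LinearMap.ext fun x => ?_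
    obtain ⟨x, y⟩ : (Y.X (j + 1) →₀ R) × (Y.X (j + 1 + 1) →₀ R) := x
    change (Y.d (j + 1) j).hom (freeEval _ x + (Y.d (j + 1 + 1) (j + 1)).hom (freeEval _ y)) =
      ((freeEval (Y.X j)).coprod ((Y.d (j + 1) j).hom ∘ₗ freeEval (Y.X (j + 1))))
        (((freeDisks Y).d (j + 1) j).hom (x, y))
    rw [freeDisks_d, map_add, ← LinearMap.comp_apply (Y.d (j + 1) j).hom (Y.d _ (j + 1)).hom,
      ← ModuleCat.hom_comp, Y.d_comp_d, LinearMap.coprod_apply, map_zero]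
    simp

instance (Y : ChainComplex (ModuleCat.{u} R) ℤ) : Epi (freeDisksEval Y) := by
  have : ∀ i, Epi ((freeDisksEval Y).f i) := fun i => by
    rw [ModuleCat.epi_iff_surjective]
    intro y
    refine ⟨((Finsupp.single y 1, 0) : (Y.X i →₀ R) × (Y.X (i + 1) →₀ R)), ?_⟩
    change freeEval (Y.X i) (Finsupp.single y 1) + (Y.d (i + 1) i).hom (freeEval _ 0) = y
    simp
  exact HomologicalComplex.epi_of_epi_f _ this

/-- A section of the epimorphism from the free disks has two components. Its second component is the
required map into degree `i + 1`; all other `map i j` are irrelevant and set to `0`. -/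
theorem exists_freeContraction (Y : ChainComplex (ModuleCat.{u} R) ℤ) [Projective Y] :
    Nonempty (FreeContraction Y) := by
  let s : Y ⟶ freeDisks Y := Projective.factorThru (𝟙 Y) (freeDisksEval Y)
  have hs : s ≫ freeDisksEval Y = 𝟙 Y := Projective.factorThru_comp _ _
  let s' : ∀ i, Y.X i →ₗ[R] (Y.X i →₀ R) × (Y.X (i + 1) →₀ R) := fun i => (s.f i).hom
  refine ⟨⟨fun i j => if h : i + 1 = j then freeCast Y h ∘ₗ LinearMap.snd R _ _ ∘ₗ s' i else 0,
    ?_⟩⟩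
  rintro k _ _ rfl rfl y
  rw [dif_pos rfl, dif_pos rfl]
  have h1 : freeEval (Y.X (k + 1)) (s' (k + 1) y).1 +
      (Y.d (k + 1 + 1) (k + 1)).hom (freeEval _ (s' (k + 1) y).2) = y :=
    LinearMap.congr_fun (congrArg (fun f : Y ⟶ Y => (f.f (k + 1)).hom) hs) y
  -- The differential of the disks moves the first component into the second. As the section is a
  -- chain map, its first component at `y` is its second component at `dy`, which turns the section
  -- identity `h1` into the homotopy identity.
  have h2 : s' k ((Y.d (k + 1) k).hom y) = (0, (s' (k + 1) y).1) :=
    (LinearMap.congr_fun (congrArg ModuleCat.Hom.hom (s.comm (k + 1) k)) y).symm.trans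
      (freeDisks_d Y k (s' (k + 1) y))
  have h3 : (freeCast Y rfl ∘ₗ LinearMap.snd R _ _ ∘ₗ s' k) ((Y.d (k + 1) k).hom y) =
      (s' (k + 1) y).1 := congrArg Prod.snd h2
  rw [h3]
  exact h1

end Contraction

end DoubleCx

namespace DoubleCx

/-! ### Elements, exactness and split sequences under the modified tensor product -/

section Bar

variable {R : Type u} [Ring R] (A : ChainComplex (ModuleCat.{u} Rᵐᵒᵖ) ℤ)

/-- The additive map `A ⊗̄ f` in degree `m`. -/
def barMap {Y Y' : ChainComplex (ModuleCat.{u} R) ℤ} (f : Y ⟶ Y') (m : ℤ) :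
    (barObj A Y).X m →+ (barObj A Y').X m :=
  (((barTensor A).map f).f m).hom

variable {A}

/-- The class of `a ⊗ y` in `A ⊗̄ Y`. -/
def barPure {Y : ChainComplex (ModuleCat.{u} R) ℤ} {i j m : ℤ} (h : i + j = m) (a : A.X i)
    (y : Y.X j) : (barObj A Y).X m :=
  QuotientAddGroup.mk (s := boundaries A Y m) (incl A Y m i j h (btmul a y))

theorem barMap_barPure {Y Y' : ChainComplex (ModuleCat.{u} R) ℤ} (f : Y ⟶ Y') {i j m : ℤ}
    (h : i + j = m) (a : A.X i) (y : Y.X j) :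
    barMap A f m (barPure h a y) = barPure h a ((f.f j).hom y) := by
  change QuotientAddGroup.mk (s := boundaries A Y' m) (totMap A f m _) = _
  rw [totMap_incl]
  rfl

theorem barMap_comp {Y Y' Y'' : ChainComplex (ModuleCat.{u} R) ℤ} (f : Y ⟶ Y') (g : Y' ⟶ Y'')
    (m : ℤ) (t : (barObj A Y).X m) : barMap A (f ≫ g) m t = barMap A g m (barMap A f m t) := by
  rw [barMap, (barTensor A).map_comp]
  rfl

variable (A) in
/-- The subgroup of `(A ⊗̄ Y)_m` generated by the classes of all `a ⊗ y` with `y` in the given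
graded subset. -/
def barSpan (Y : ChainComplex (ModuleCat.{u} R) ℤ) (m : ℤ) (S : ∀ j, Set (Y.X j)) :
    AddSubgroup ((barObj A Y).X m) :=
  AddSubgroup.closure {t | ∃ (i j : ℤ) (h : i + j = m) (a : A.X i) (y : Y.X j), y ∈ S j ∧
    t = barPure h a y}

theorem barSpan_mono {Y : ChainComplex (ModuleCat.{u} R) ℤ} {m : ℤ} {S S' : ∀ j, Set (Y.X j)}
    (h : ∀ j, S j ⊆ S' j) : barSpan A Y m S ≤ barSpan A Y m S' :=
  AddSubgroup.closure_mono fun _ ⟨i, j, hm, a, y, hy, ht⟩ => ⟨i, j, hm, a, y, h j hy, ht⟩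

theorem barSpan_univ (Y : ChainComplex (ModuleCat.{u} R) ℤ) (m : ℤ) :
    barSpan A Y m (fun _ => Set.univ) = ⊤ := by
  set H := barSpan A Y m (fun _ => Set.univ) with hH
  have : (QuotientAddGroup.mk' H).comp (QuotientAddGroup.mk' (boundaries A Y m)) = 0 := by
    apply tot_hom_ext
    intro i j h a y
    refine (QuotientAddGroup.eq_zero_iff _).2 (AddSubgroup.subset_closure ?_)
    exact ⟨i, j, h, a, y, trivial, rfl⟩
  refine eq_top_iff.2 fun t _ => ?_
  obtain ⟨t, rfl⟩ := QuotientAddGroup.mk_surjective t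
  exact (QuotientAddGroup.eq_zero_iff _).1 (DFunLike.congr_fun this t)

/-- This lets exactness for a subobject be tested on a subgroup generated inside the ambient tensor
product, where a closing-off argument can reach it. -/
theorem range_barMap {Y Y' : ChainComplex (ModuleCat.{u} R) ℤ} (f : Y ⟶ Y') (m : ℤ) :
    (barMap A f m).range = barSpan A Y' m (fun j => Set.range (f.f j).hom) := by
  rw [AddMonoidHom.range_eq_map, ← barSpan_univ, barSpan, AddMonoidHom.map_closure]
  congr 1
  ext t
  constructor
  · rintro ⟨_, ⟨i, j, h, a, y, -, rfl⟩, rfl⟩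
    exact ⟨i, j, h, a, _, ⟨y, rfl⟩, barMap_barPure f h a y⟩
  · rintro ⟨i, j, h, a, _, ⟨y, rfl⟩, rfl⟩
    exact ⟨_, ⟨i, j, h, a, y, trivial, rfl⟩, barMap_barPure f h a y⟩

/-- Exactness of `A ⊗̄ Y` in terms of elements. -/
theorem acyclic_tensorDouble_iff (Y : DoubleComplex R) :
    (tensorDouble A Y).Acyclic ↔ ∀ (n m : ℤ) (t : (barObj A (Y.X (n + 1))).X m),
      barMap A (Y.d (n + 1) n) m t = 0 →
        ∃ w : (barObj A (Y.X (n + 1 + 1))).X m, barMap A (Y.d (n + 1 + 1) (n + 1)) m w = t := by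
  have key : ∀ n, (tensorDouble A Y).ExactAt (n + 1) ↔ ∀ (m : ℤ)
      (t : (barObj A (Y.X (n + 1))).X m), barMap A (Y.d (n + 1) n) m t = 0 →
        ∃ w : (barObj A (Y.X (n + 1 + 1))).X m,
          barMap A (Y.d (n + 1 + 1) (n + 1)) m w = t := fun n => by
    rw [HomologicalComplex.exactAt_iff' _ (n + 1 + 1) (n + 1) n (by simp) (by simp)]
    constructor
    · intro h m
      have := (h.map (HomologicalComplex.eval _ _ m))
      rw [ShortComplex.ab_exact_iff] at this
      exact this
    · intro h
      refine HomologicalComplex.exact_of_degreewise_exact _ fun m => ?_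
      rw [ShortComplex.ab_exact_iff]
      exact h m
  constructor
  · exact fun h n => (key n).1 (h (n + 1))
  · intro h n
    obtain ⟨k, rfl⟩ : ∃ k, n = k + 1 := ⟨n - 1, by omega⟩
    exact (key k).2 (h k)

theorem barMap_d_comm {X Y : DoubleComplex R} (f : X ⟶ Y) (n n' m : ℤ)
    (t : (barObj A (X.X n)).X m) :
    barMap A (f.f n') m (barMap A (X.d n n') m t) =
      barMap A (Y.d n n') m (barMap A (f.f n) m t) := by
  rw [← barMap_comp, ← barMap_comp, f.comm]

/-- If `A ⊗̄ f` is injective, exactness of the source can be tested on the image. -/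
theorem acyclic_of_injective {X Y : DoubleComplex R} (f : X ⟶ Y)
    (hf : ∀ n m, Function.Injective (barMap A (f.f n) m))
    (h : ∀ n m, ∀ t ∈ (barMap A (f.f (n + 1)) m).range, barMap A (Y.d (n + 1) n) m t = 0 →
      ∃ w ∈ (barMap A (f.f (n + 1 + 1)) m).range, barMap A (Y.d (n + 1 + 1) (n + 1)) m w = t) :
    (tensorDouble A X).Acyclic := by
  rw [acyclic_tensorDouble_iff]
  intro n m t ht
  obtain ⟨_, ⟨w, rfl⟩, hw⟩ := h n m _ ⟨t, rfl⟩ (by rw [← barMap_d_comm, ht, map_zero])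
  exact ⟨w, hf _ _ (by rw [barMap_d_comm, hw])⟩

/-- Exactness passes to a double complex exhausted by exact ones. -/
theorem acyclic_of_exhausted {ι : Type*} {X : ι → DoubleComplex R} {Y : DoubleComplex R}
    (f : ∀ k, X k ⟶ Y) (hf : ∀ k n m, Function.Injective (barMap A ((f k).f n) m))
    (hX : ∀ k, (tensorDouble A (X k)).Acyclic)
    (h : ∀ n m (t : (barObj A (Y.X n)).X m), ∃ k, t ∈ (barMap A ((f k).f n) m).range) :
    (tensorDouble A Y).Acyclic := by
  rw [acyclic_tensorDouble_iff]
  intro n m t ht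
  obtain ⟨k, t, rfl⟩ := h _ _ t
  obtain ⟨w, rfl⟩ := (acyclic_tensorDouble_iff _).1 (hX k) n m t
    (hf k _ _ (by rw [barMap_d_comm, ht, map_zero]))
  exact ⟨_, (barMap_d_comm _ _ _ _ _).symm⟩

/-- A sequence of complexes that is short exact in each degree, with a projective complex on the
right, is split. -/
noncomputable def splittingOfDegreewise (S : ShortComplex (ChainComplex (ModuleCat.{u} R) ℤ))
    (hi : ∀ m, Function.Injective (S.f.f m).hom) (hs : ∀ m, Function.Surjective (S.g.f m).hom)
    (he : ∀ m (y : S.X₂.X m), (S.g.f m).hom y = 0 → ∃ x, (S.f.f m).hom x = y)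
    [Projective S.X₃] : S.Splitting :=
  ShortComplex.ShortExact.splittingOfProjective
    (HomologicalComplex.shortExact_of_degreewise_shortExact S fun m =>
      { exact := (ShortComplex.moduleCat_exact_iff _).2 (he m)
        mono_f := (ModuleCat.mono_iff_injective _).2 (hi m)
        epi_g := (ModuleCat.epi_iff_surjective _).2 (hs m) })

/-- A degreewise short exact sequence of double complexes with projective complexes on the right. -/
structure IsDegreewiseSplit (S : ShortComplex (DoubleComplex R)) : Prop where
  inj : ∀ n m, Function.Injective ((S.f.f n).f m).hom
  surj : ∀ n m, Function.Surjective ((S.g.f n).f m).hom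
  exact : ∀ n m (y : (S.X₂.X n).X m), ((S.g.f n).f m).hom y = 0 → ∃ x, ((S.f.f n).f m).hom x = y
  projective : ∀ n, Projective (S.X₃.X n)

variable {S : ShortComplex (DoubleComplex R)}

/-- The splitting exists for each outer degree separately and need not respect the outer
differential. That is enough for `A ⊗̄ -`, which is additive and applied degree by degree. -/
theorem IsDegreewiseSplit.nonempty_splitting (hS : IsDegreewiseSplit S) (n : ℤ) :
    Nonempty (S.map (HomologicalComplex.eval _ _ n)).Splitting := by
  have : Projective (S.map (HomologicalComplex.eval _ _ n)).X₃ := hS.projective n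
  exact ⟨splittingOfDegreewise _ (hS.inj n) (hS.surj n) (hS.exact n)⟩

variable (A)

theorem IsDegreewiseSplit.barMap_injective (hS : IsDegreewiseSplit S) (n m : ℤ) :
    Function.Injective (barMap A (S.f.f n) m) := by
  obtain ⟨s⟩ := hS.nonempty_splitting n
  exact (s.map (barTensor A ⋙ HomologicalComplex.eval _ _ m)).shortExact.ab_injective_f

theorem IsDegreewiseSplit.shortExact_tensorDouble (hS : IsDegreewiseSplit S) :
    (S.map ((barTensor A).mapHomologicalComplex (ComplexShape.down ℤ))).ShortExact := by
  refine HomologicalComplex.shortExact_of_degreewise_shortExact _ fun n => ?_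
  obtain ⟨s⟩ := hS.nonempty_splitting n
  exact (s.map (barTensor A)).shortExact

variable {A}

/-- In the long exact homology sequence the middle term sits between two vanishing ones; `acyclic₃`
uses the connecting map in the same way. -/
theorem IsDegreewiseSplit.acyclic₂ (hS : IsDegreewiseSplit S)
    (h₁ : (tensorDouble A S.X₁).Acyclic) (h₃ : (tensorDouble A S.X₃).Acyclic) :
    (tensorDouble A S.X₂).Acyclic := fun n => by
  have h := (hS.shortExact_tensorDouble A).homology_exact₂ n
  rw [HomologicalComplex.exactAt_iff_isZero_homology]
  exact h.isZero_of_both_zeros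
    (((HomologicalComplex.exactAt_iff_isZero_homology _ _).1 (h₁ n)).eq_of_src _ _)
    (((HomologicalComplex.exactAt_iff_isZero_homology _ _).1 (h₃ n)).eq_of_tgt _ _)

theorem IsDegreewiseSplit.acyclic₃ (hS : IsDegreewiseSplit S)
    (h₁ : (tensorDouble A S.X₁).Acyclic) (h₂ : (tensorDouble A S.X₂).Acyclic) :
    (tensorDouble A S.X₃).Acyclic := fun n => by
  have h := (hS.shortExact_tensorDouble A).homology_exact₃ n (n - 1) (by simp)
  rw [HomologicalComplex.exactAt_iff_isZero_homology]
  exact h.isZero_of_both_zeros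
    (((HomologicalComplex.exactAt_iff_isZero_homology _ _).1 (h₂ n)).eq_of_src _ _)
    (((HomologicalComplex.exactAt_iff_isZero_homology _ _).1 (h₁ (n - 1))).eq_of_tgt _ _)

theorem IsAcyclicOfProjectives.of_iso {X Y : DoubleComplex R} (e : X ≅ Y)
    (h : IsAcyclicOfProjectives A X) : IsAcyclicOfProjectives A Y where
  projective n := Projective.of_iso ((HomologicalComplex.eval _ _ n).mapIso e) (h.projective n)
  exact n := (h.exact n).of_iso
    (((barTensor A).mapHomologicalComplex (ComplexShape.down ℤ)).mapIso e)

theorem isIso_of_bijective {X Y : DoubleComplex R} (f : X ⟶ Y)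
    (hf : ∀ n m, Function.Bijective ((f.f n).f m).hom) : IsIso f := by
  have : ∀ n, IsIso (f.f n) := fun n => by
    have : ∀ m, IsIso ((f.f n).f m) := fun m =>
      (ConcreteCategory.isIso_iff_bijective _).2 (hf n m)
    exact HomologicalComplex.Hom.isIso_of_components _
  exact HomologicalComplex.Hom.isIso_of_components _

end Bar

end DoubleCx

namespace DoubleCx

/-! ### Stable subcomplexes and their quotients -/

namespace Subcomplex

variable {R : Type u} [Ring R] {P : DoubleComplex R}

instance : LE (Subcomplex P) := ⟨fun Q Q' => ∀ n m, Q.carrier n m ≤ Q'.carrier n m⟩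

instance : Top (Subcomplex P) := ⟨⟨fun _ _ => ⊤, fun _ _ _ _ _ => trivial, fun _ _ _ _ _ => trivial⟩⟩

instance : Bot (Subcomplex P) :=
  ⟨⟨fun _ _ => ⊥, fun _ _ _ => bot_le, fun _ _ _ => bot_le⟩⟩

theorem mem_bot {n m : ℤ} {x : (P.X n).X m} :
    x ∈ (⊥ : Subcomplex P).carrier n m ↔ x = 0 := Iff.rfl

theorem mem_top {n m : ℤ} (x : (P.X n).X m) : x ∈ (⊤ : Subcomplex P).carrier n m := trivial

theorem le_refl (Q : Subcomplex P) : Q ≤ Q := fun _ _ _ h => h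

theorem bot_le (Q : Subcomplex P) : ⊥ ≤ Q := fun _ _ => _root_.bot_le

theorem le_top (Q : Subcomplex P) : Q ≤ ⊤ := fun _ _ _ _ => trivial

/-- The class in `Q' / Q` of an element of `Q'`. -/
def qmk (Q' Q : Subcomplex P) {n m : ℤ} (x : (P.X n).X m) (hx : x ∈ Q'.carrier n m) :
    ((Q'.quotient Q).X n).X m :=
  Submodule.Quotient.mk (p := inside Q' Q n m) ⟨x, hx⟩

variable {Q Q' Q'' : Subcomplex P} {n m : ℤ}

theorem exists_qmk (t : ((Q'.quotient Q).X n).X m) : ∃ x hx, qmk Q' Q x hx = t := by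
  obtain ⟨⟨x, hx⟩, rfl⟩ := Submodule.Quotient.mk_surjective (inside Q' Q n m) t
  exact ⟨x, hx, rfl⟩

theorem qmk_eq_zero {x : (P.X n).X m} {hx : x ∈ Q'.carrier n m} :
    qmk Q' Q x hx = 0 ↔ x ∈ Q.carrier n m :=
  Submodule.Quotient.mk_eq_zero _

theorem qmk_eq {x y : (P.X n).X m} {hx : x ∈ Q'.carrier n m} {hy : y ∈ Q'.carrier n m} :
    qmk Q' Q x hx = qmk Q' Q y hy ↔ x - y ∈ Q.carrier n m :=
  Submodule.Quotient.eq _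

/-- The map `Q₁' / Q₁ → Q₂' / Q₂` induced by inclusions. -/
def quotMap {Q₁ Q₁' Q₂ Q₂' : Subcomplex P} (h : Q₁ ≤ Q₂) (h' : Q₁' ≤ Q₂') :
    Q₁'.quotient Q₁ ⟶ Q₂'.quotient Q₂ where
  f n :=
    { f := fun m => ModuleCat.ofHom (Submodule.mapQ (inside Q₁' Q₁ n m) (inside Q₂' Q₂ n m)
        (Submodule.inclusion (h' n m)) (fun _ hx => h n m hx))
      comm' := fun m m' _ => by
        ext1
        apply Submodule.linearMap_qext
        ext x
        rfl }
  comm' n n' _ := by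
    ext m : 2
    apply Submodule.linearMap_qext
    ext x
    rfl

theorem quotient_d_qmk (n m m' : ℤ) (x : (P.X n).X m) (hx : x ∈ Q'.carrier n m) :
    (((Q'.quotient Q).X n).d m m').hom (qmk Q' Q x hx) =
      qmk Q' Q (((P.X n).d m m').hom x) (Q'.inner_mem n m m' hx) := rfl

/-- The canonical map from `Q` to `Q / 0`. -/
def toQuotientBot (Q : Subcomplex P) : Q.toDouble ⟶ Q.quotient ⊥ where
  f n := { f := fun m => ModuleCat.ofHom (inside Q ⊥ n m).mkQ }

/-- Subcomplexes, and `P` itself, are treated as quotients by `⊥`, so that the results on quotients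
cover all cases at once. -/
theorem toQuotientBot_bijective (Q : Subcomplex P) (n m : ℤ) :
    Function.Bijective ((Q.toQuotientBot.f n).f m).hom := by
  refine ⟨fun (x y : Q.carrier n m) h => ?_, Submodule.Quotient.mk_surjective (inside Q ⊥ n m)⟩
  exact Subtype.ext (sub_eq_zero.1 (qmk_eq (hx := x.2) (hy := y.2).1 h))

/-- The canonical map from `P` to `P / 0`. -/
def toTopQuotientBot (P : DoubleComplex R) : P ⟶ (⊤ : Subcomplex P).quotient ⊥ where
  f n := { f := fun m => ModuleCat.ofHom ((inside ⊤ ⊥ n m).mkQ ∘ₗ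
    LinearMap.codRestrict _ LinearMap.id fun _ => trivial) }

theorem toTopQuotientBot_bijective (P : DoubleComplex R) (n m : ℤ) :
    Function.Bijective (((toTopQuotientBot P).f n).f m).hom := by
  refine ⟨(injective_iff_map_eq_zero _).2 fun x hx => ?_, fun t => ?_⟩
  · exact (Submodule.Quotient.mk_eq_zero (inside ⊤ ⊥ n m)).1 hx
  · obtain ⟨x, hx, rfl⟩ := exists_qmk t
    exact ⟨x, rfl⟩

/-- The subcomplex is stable under the given contractions of the `P_n`. -/
def Stable (C : ∀ n, FreeContraction (P.X n)) (Q : Subcomplex P) : Prop :=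
  ∀ n i j, ∀ x ∈ Q.carrier n i, (C n).map i j x ∈ Finsupp.supported R R (Q.carrier n j : Set _)

variable {C : ∀ n, FreeContraction (P.X n)}

theorem stable_top : Stable C ⊤ := fun _ _ _ _ _ _ _ => trivial

theorem stable_bot : Stable C ⊥ := fun n i j x hx => by
  rw [mem_bot.1 hx, map_zero]
  exact zero_mem _

open Classical in
/-- Subquotients of stable subcomplexes are projective in each outer degree. -/
theorem Stable.projective_quotient (hQ : Stable C Q) (hQ' : Stable C Q') (n : ℤ) :
    Projective ((Q'.quotient Q).X n) := by
  -- Deleting the basis elements that lie in `Q` makes the contraction vanish on `Q`, by stability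
  -- of `Q`, so that it factors through `Q' / Q` as `b`.
  let kill : ∀ j, ((P.X n).X j →₀ R) →ₗ[R] ((P.X n).X j →₀ R) := fun j =>
    Finsupp.linearCombination R fun y => if y ∈ Q.carrier n j then 0 else Finsupp.single y 1
  have hkill : ∀ j, ∀ f ∈ Finsupp.supported R R (Q.carrier n j : Set ((P.X n).X j)),
      kill j f = 0 := fun j f hf => by
    rw [Finsupp.linearCombination_apply]
    refine Finset.sum_eq_zero fun y hy => ?_
    dsimp only
    rw [if_pos (show y ∈ Q.carrier n j from hf hy), smul_zero]
  let b : ∀ i j, ((Q'.quotient Q).X n).X i →ₗ[R] ((P.X n).X j →₀ R) := fun i j =>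
    (inside Q' Q n i).liftQ (kill j ∘ₗ (C n).map i j ∘ₗ (Q'.carrier n i).subtype)
      fun x hx => hkill _ _ (hQ n i j _ hx)
  -- The value `0` outside `Q'` is a dummy: stability of `Q'` keeps the relevant supports inside
  -- `Q'`.
  let c : ∀ j, ((P.X n).X j →₀ R) →ₗ[R] ((Q'.quotient Q).X n).X j := fun j =>
    Finsupp.linearCombination R fun y => if h : y ∈ Q'.carrier n j then qmk Q' Q y h else 0
  -- Deleting basis elements of `Q` does no harm, since their classes in `Q' / Q` are zero.
  have heval : ∀ j, ∀ f ∈ Finsupp.supported R R (Q'.carrier n j : Set ((P.X n).X j)),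
      ∃ h : freeEval _ f ∈ Q'.carrier n j, c j (kill j f) = qmk Q' Q (freeEval _ f) h := by
    intro j f hf
    rw [Finsupp.supported_eq_span_single] at hf
    induction hf using Submodule.span_induction with
    | mem f hf =>
      obtain ⟨y, hy, rfl⟩ := hf
      have h1 : freeEval _ (Finsupp.single y (1 : R)) = y := by simp
      refine ⟨by rwa [h1], ?_⟩
      have h2 : qmk Q' Q (freeEval _ (Finsupp.single y (1 : R))) (by rwa [h1]) =
          qmk Q' Q y hy := by congr 1
      rw [h2, Finsupp.linearCombination_single, one_smul]
      split_ifs with h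
      · rw [map_zero, qmk_eq_zero.2 h]
      · rw [Finsupp.linearCombination_single, one_smul, dif_pos (show y ∈ Q'.carrier n j from hy)]
    | zero =>
      refine ⟨by rw [map_zero]; exact zero_mem _, ?_⟩
      rw [map_zero, map_zero, eq_comm, qmk_eq_zero, map_zero]
      exact zero_mem _
    | add f g _ _ hf hg =>
      obtain ⟨hf, hf'⟩ := hf
      obtain ⟨hg, hg'⟩ := hg
      refine ⟨by rw [map_add]; exact add_mem hf hg, ?_⟩
      rw [map_add, map_add, hf', hg']
      refine Eq.trans (Submodule.Quotient.mk_add _).symm ?_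
      refine qmk_eq.2 ?_
      rw [map_add, sub_self]
      exact zero_mem _
    | smul r f _ hf =>
      obtain ⟨hf, hf'⟩ := hf
      refine ⟨by rw [map_smul]; exact Submodule.smul_mem _ _ hf, ?_⟩
      rw [map_smul, map_smul, hf']
      refine Eq.trans (Submodule.Quotient.mk_smul _ _ _).symm ?_
      refine qmk_eq.2 ?_
      rw [map_smul, sub_self]
      exact zero_mem _
  refine projective_of_contraction _ (fun j => (P.X n).X j →₀ R) b c ?_
  intro k i j hk hj z
  obtain ⟨x, hx, rfl⟩ := exists_qmk z
  obtain ⟨h1, h1'⟩ := heval i _ (hQ' n k i _ (Q'.inner_mem n i k hx))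
  obtain ⟨h2, h2'⟩ := heval j _ (hQ' n i j _ hx)
  change c i (kill i ((C n).map k i (((P.X n).d i k).hom x))) +
    (((Q'.quotient Q).X n).d j i).hom (c j (kill j ((C n).map i j x))) = _
  rw [h1', h2', quotient_d_qmk]
  refine Eq.trans (Submodule.Quotient.mk_add _).symm ?_
  refine qmk_eq.2 ?_
  change freeEval _ _ + ((P.X n).d j i).hom _ - x ∈ _
  rw [(C n).map_eq k i j hk hj, sub_self]
  exact zero_mem _

/-- The sequence `Q' / Q → Q'' / Q → Q'' / Q'`. -/
def quotientSequence (h : Q ≤ Q') (h' : Q' ≤ Q'') : ShortComplex (DoubleComplex R) :=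
  ShortComplex.mk (quotMap (le_refl Q) h') (quotMap h (le_refl Q'')) (by
    ext n m : 2
    apply ModuleCat.hom_ext
    refine LinearMap.ext fun t => ?_
    obtain ⟨x, hx, rfl⟩ := exists_qmk t
    exact qmk_eq_zero.2 hx)

/-- Exactness is the third isomorphism theorem; stability serves to make the right-hand term
projective. -/
theorem Stable.isDegreewiseSplit (h : Q ≤ Q') (h' : Q' ≤ Q'') (hQ' : Stable C Q')
    (hQ'' : Stable C Q'') : IsDegreewiseSplit (quotientSequence h h') where
  inj n m := (injective_iff_map_eq_zero _).2 fun t ht => by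
    obtain ⟨x, hx, rfl⟩ := exists_qmk t
    exact qmk_eq_zero.2 (qmk_eq_zero.1 ht)
  surj n m t := by
    obtain ⟨x, hx, rfl⟩ := exists_qmk t
    exact ⟨qmk Q'' Q x hx, rfl⟩
  exact n m t ht := by
    obtain ⟨x, hx, rfl⟩ := exists_qmk (Q := Q) (Q' := Q'') t
    exact ⟨qmk Q' Q x (qmk_eq_zero.1 ht), rfl⟩
  projective := hQ'.projective_quotient hQ''

end Subcomplex

end DoubleCx

namespace DoubleCx

open Cardinal

/-! ### Small sets of elements on which exactness holds -/

section Closure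

variable {R : Type u} [Ring R] {A : ChainComplex (ModuleCat.{u} Rᵐᵒᵖ) ℤ} {κ : Cardinal.{u}}

/-- The elements of a double complex. -/
abbrev Elements (Y : DoubleComplex R) : Type u := Σ n : ℤ, Σ m : ℤ, (Y.X n).X m

/-- The elements of bidegree `(n, m)` in a set of elements of a double complex. -/
def slice {Y : DoubleComplex R} (S : Set (Elements Y)) (n m : ℤ) : Set ((Y.X n).X m) :=
  {y | (⟨n, m, y⟩ : Elements Y) ∈ S}

theorem mk_slice_le {Y : DoubleComplex R} (S : Set (Elements Y)) (n m : ℤ) :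
    #(slice S n m) ≤ #S :=
  mk_preimage_of_injective (fun y => (⟨n, m, y⟩ : Elements Y)) S fun _ _ h =>
    eq_of_heq (Sigma.mk.inj (eq_of_heq (Sigma.mk.inj h).2)).2

/-- This finiteness makes the choice of preimages of cycles a finitary operation, to which
`exists_small_closed` applies. -/
theorem exists_finset_barSpan_slice {Y : DoubleComplex R} {S : Set (Elements Y)} {n m : ℤ}
    {t : (barObj A (Y.X n)).X m} (ht : t ∈ barSpan A (Y.X n) m (slice S n)) :
    ∃ F : Finset (Elements Y), ↑F ⊆ S ∧ t ∈ barSpan A (Y.X n) m (slice (F : Set (Elements Y)) n) := by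
  classical
  have mono : ∀ {F G : Finset (Elements Y)}, F ⊆ G →
      barSpan A (Y.X n) m (slice (F : Set (Elements Y)) n) ≤
        barSpan A (Y.X n) m (slice (G : Set (Elements Y)) n) := fun h =>
    barSpan_mono fun _ _ hy => h hy
  induction ht using AddSubgroup.closure_induction with
  | mem t ht =>
    obtain ⟨i, j, h, a, y, hy, rfl⟩ := ht
    refine ⟨{⟨n, j, y⟩}, by simpa [slice] using hy, AddSubgroup.subset_closure ?_⟩
    exact ⟨i, j, h, a, y, by simp [slice], rfl⟩
  | zero => exact ⟨∅, by simp, zero_mem _⟩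
  | add t u _ _ ht hu =>
    obtain ⟨F, hF, ht⟩ := ht
    obtain ⟨G, hG, hu⟩ := hu
    refine ⟨F ∪ G, by simpa using ⟨hF, hG⟩, add_mem ?_ ?_⟩
    · exact mono Finset.subset_union_left ht
    · exact mono Finset.subset_union_right hu
  | neg t _ ht =>
    obtain ⟨F, hF, ht⟩ := ht
    exact ⟨F, hF, neg_mem ht⟩

theorem mk_barSpan_slice_lt (hκ : κ.IsRegular) (hω : ℵ₀ < κ) (hA : card A < κ)
    {Y : DoubleComplex R} {S : Set (Elements Y)} (hS : #S < κ) (n m : ℤ) :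
    #(barSpan A (Y.X n) m (slice S n)) < κ := by
  refine mk_addSubgroup_closure_lt hω ?_
  -- The generators are indexed by pairs from `A` and `S`; a pair gives at most one, because `b`
  -- determines both `j` and `y`.
  refine (mk_le_mk_of_subset (t := ⋃ a : Σ i, A.X i, ⋃ b : S, {t | ∃ (j : ℤ) (h : a.1 + j = m)
    (y : (Y.X n).X j), b.1 = ⟨n, j, y⟩ ∧ t = barPure h a.2 y}) ?_).trans_lt ?_
  · rintro _ ⟨i, j, h, a, y, hy, rfl⟩
    exact Set.mem_iUnion.2 ⟨⟨i, a⟩, Set.mem_iUnion.2 ⟨⟨_, hy⟩, j, h, y, rfl, rfl⟩⟩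
  · refine mk_iUnion_lt_of_isRegular hκ hA fun a => mk_iUnion_lt_of_isRegular hκ hS fun b => ?_
    refine (mk_le_one_iff_set_subsingleton.2 ?_).trans_lt (one_lt_aleph0.trans hω)
    rintro _ ⟨j, h, y, hb, rfl⟩ _ ⟨j', h', y', hb', rfl⟩
    rw [hb] at hb'
    cases hb'
    rfl

/-- A small set of elements of an exact double complex can be enlarged to a small set that is closed
under a given finitary operation, and on which `A ⊗̄ Y` is exact. -/
theorem exists_small_exact (hκ : κ.IsRegular) (hω : ℵ₀ < κ) (hA : card A < κ)
    {Y : DoubleComplex R} (hY : (tensorDouble A Y).Acyclic)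
    (Φ : Finset (Elements Y) → Set (Elements Y)) (hΦ : ∀ F, #(Φ F) < κ)
    (S : Set (Elements Y)) (hS : #S < κ) :
    ∃ T : Set (Elements Y), S ⊆ T ∧ #T < κ ∧ (∀ F : Finset (Elements Y), ↑F ⊆ T → Φ F ⊆ T) ∧
      ∀ n m, ∀ t ∈ barSpan A (Y.X (n + 1)) m (slice T (n + 1)), barMap A (Y.d (n + 1) n) m t = 0 →
        ∃ w ∈ barSpan A (Y.X (n + 1 + 1)) m (slice T (n + 1 + 1)),
          barMap A (Y.d (n + 1 + 1) (n + 1)) m w = t := by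
  have hwit : ∀ (n m : ℤ) (t : {t : (barObj A (Y.X (n + 1))).X m //
      barMap A (Y.d (n + 1) n) m t = 0}), ∃ F : Finset (Elements Y),
        ∃ w ∈ barSpan A (Y.X (n + 1 + 1)) m (slice (F : Set (Elements Y)) (n + 1 + 1)),
          barMap A (Y.d (n + 1 + 1) (n + 1)) m w = t.1 := by
    rintro n m ⟨t, ht⟩
    obtain ⟨w, hw⟩ := (acyclic_tensorDouble_iff Y).1 hY n m t ht
    have hw' : w ∈ barSpan A (Y.X (n + 1 + 1)) m
        (slice (Set.univ : Set (Elements Y)) (n + 1 + 1)) :=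
      (barSpan_univ (A := A) (Y.X (n + 1 + 1)) m).ge trivial
    obtain ⟨F, -, hF⟩ := exists_finset_barSpan_slice hw'
    exact ⟨F, w, hF, hw⟩
  choose wit hwit using hwit
  -- Besides `Φ F`, adjoin for each cycle generated by `F` the finite set supporting its chosen
  -- preimage. A cycle over the closed set comes from a finite part of it, so its preimage is
  -- available there too.
  let Ψ : Finset (Elements Y) → Set (Elements Y) := fun F => Φ F ∪ ⋃ n, ⋃ m,
    ⋃ t : barSpan A (Y.X (n + 1)) m (slice (F : Set (Elements Y)) (n + 1)),
      {b | ∃ ht : barMap A (Y.d (n + 1) n) m t.1 = 0, b ∈ wit n m ⟨t.1, ht⟩}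
  have hΨ : ∀ F, #(Ψ F) < κ := fun F => by
    refine mk_union_lt hω.le (hΦ F) (mk_iUnion_lt_of_countable hκ hω fun n =>
      mk_iUnion_lt_of_countable hκ hω fun m => mk_iUnion_lt_of_isRegular hκ
        (mk_barSpan_slice_lt hκ hω hA ?_ _ _) fun t => ?_)
    · exact (F.finite_toSet.lt_aleph0).trans hω
    · by_cases ht : barMap A (Y.d (n + 1) n) m t.1 = 0
      · refine (mk_le_mk_of_subset (t := (wit n m ⟨t.1, ht⟩ : Set (Elements Y))) ?_).trans_lt
          ((Finset.finite_toSet _).lt_aleph0.trans hω)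
        rintro b ⟨_, hb⟩
        exact hb
      · refine (mk_le_mk_of_subset (t := ∅) ?_).trans_lt (by simpa using hκ.pos)
        rintro b ⟨ht', _⟩
        exact ht ht'
  obtain ⟨T, hST, hT, hcl⟩ := exists_small_closed hκ hω Ψ hΨ S hS
  refine ⟨T, hST, hT, fun F hF => Set.subset_union_left.trans (hcl F hF), fun n m t ht ht0 => ?_⟩
  obtain ⟨F, hF, htF⟩ := exists_finset_barSpan_slice ht
  obtain ⟨w, hw, hwt⟩ := hwit n m ⟨t, ht0⟩
  refine ⟨w, barSpan_mono (fun j y hy => hcl F hF (Or.inr ?_)) hw, hwt⟩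
  simp only [Set.mem_iUnion]
  exact ⟨n, m, ⟨t, htF⟩, ht0, hy⟩

end Closure

/-! ### Enlarging a stable subcomplex by a small amount -/

namespace Subcomplex

variable {R : Type u} [Ring R] {A : ChainComplex (ModuleCat.{u} Rᵐᵒᵖ) ℤ} {κ : Cardinal.{u}}
  {P : DoubleComplex R} {C : ∀ n, FreeContraction (P.X n)}

/-- The preimage in `P` of a subset of `P / Q` that is closed under the operations. -/
def preimage (Q : Subcomplex P) (T : Set (Elements ((⊤ : Subcomplex P).quotient Q)))
    (hspan : ∀ n m x, x ∈ Submodule.span R (slice T n m) → x ∈ slice T n m)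
    (hinner : ∀ n m m', ∀ x ∈ slice T n m,
      ((((⊤ : Subcomplex P).quotient Q).X n).d m m').hom x ∈ slice T n m')
    (houter : ∀ n n' m, ∀ x ∈ slice T n m,
      ((((⊤ : Subcomplex P).quotient Q).d n n').f m).hom x ∈ slice T n' m) : Subcomplex P where
  carrier n m :=
    { carrier := {x | qmk ⊤ Q x (mem_top _) ∈ slice T n m}
      add_mem' := fun {x y} hx hy => hspan n m (qmk ⊤ Q x (mem_top _) + qmk ⊤ Q y (mem_top _))
        (add_mem (Submodule.subset_span (s := slice T n m) hx) (Submodule.subset_span hy))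
      zero_mem' := hspan n m 0 (zero_mem _)
      smul_mem' := fun r x hx => hspan n m (r • qmk ⊤ Q x (mem_top _))
        (Submodule.smul_mem _ r (Submodule.subset_span (s := slice T n m) hx)) }
  inner_mem n m m' _ hx := hinner n m m' _ hx
  outer_mem n n' m _ hx := houter n n' m _ hx

/-- A stable subcomplex can be enlarged by a small amount to a stable subcomplex that contains a
given small set, with exact quotient. -/
theorem Stable.exists_step (hκ : κ.IsRegular) (hω : ℵ₀ < κ) (hR : #R < κ) (hA : card A < κ)
    {Q : Subcomplex P} (hQ : Stable C Q)
    (hex : (tensorDouble A ((⊤ : Subcomplex P).quotient Q)).Acyclic)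
    (S : Set (Elements P)) (hS : #S < κ) :
    ∃ Q' : Subcomplex P, Q ≤ Q' ∧ Stable C Q' ∧ (∀ b ∈ S, b.2.2 ∈ Q'.carrier b.1 b.2.1) ∧
      (tensorDouble A (Q'.quotient Q)).Acyclic ∧ cardDouble (Q'.quotient Q) < κ := by
  -- The closing-off takes place in `P / Q`, since `Q` itself may have `κ` or more elements.
  set Y := (⊤ : Subcomplex P).quotient Q with hYdef
  let toY : Elements P → Elements Y := fun b => ⟨b.1, b.2.1, qmk ⊤ Q b.2.2 (mem_top _)⟩
  have hsec : ∀ (n m : ℤ) (t : (Y.X n).X m), ∃ x, qmk ⊤ Q x (mem_top _) = t := fun n m t => by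
    obtain ⟨x, hx, h⟩ := exists_qmk t
    exact ⟨x, h⟩
  choose sec hsec using hsec
  -- Inner differentials, outer differentials, and the classes of the basis elements in the
  -- contraction of one chosen lift.
  let op : Elements Y → Set (Elements Y) := fun b =>
    (⋃ m' : ℤ, {⟨b.1, m', ((Y.X b.1).d b.2.1 m').hom b.2.2⟩}) ∪
    (⋃ n' : ℤ, {⟨n', b.2.1, ((Y.d b.1 n').f b.2.1).hom b.2.2⟩}) ∪
    ⋃ j : ℤ, (fun y => ⟨b.1, j, qmk ⊤ Q y (mem_top _)⟩) ''
      (((C b.1).map b.2.1 j (sec b.1 b.2.1 b.2.2)).support : Set ((P.X b.1).X j))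
  have hop : ∀ b, #(op b) < κ := fun b => by
    refine mk_union_lt hω.le (mk_union_lt hω.le ?_ ?_) ?_
    · exact mk_iUnion_lt_of_countable hκ hω fun _ => by
        rw [mk_singleton]; exact one_lt_aleph0.trans hω
    · exact mk_iUnion_lt_of_countable hκ hω fun _ => by
        rw [mk_singleton]; exact one_lt_aleph0.trans hω
    · exact mk_iUnion_lt_of_countable hκ hω fun j =>
        ((Finset.finite_toSet _).image _).lt_aleph0.trans hω
  let Φ : Finset (Elements Y) → Set (Elements Y) := fun F =>
    (⋃ n : ℤ, ⋃ m : ℤ, (fun x => (⟨n, m, x⟩ : Elements Y)) ''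
      (Submodule.span R (slice (F : Set (Elements Y)) n m) : Set ((Y.X n).X m))) ∪
    ⋃ b : (F : Set (Elements Y)), op b.1
  have hΦ : ∀ F, #(Φ F) < κ := fun F => by
    have hF : #(F : Set (Elements Y)) < κ := F.finite_toSet.lt_aleph0.trans hω
    refine mk_union_lt hω.le ?_ (mk_iUnion_lt_of_isRegular hκ hF fun b => hop b.1)
    refine mk_iUnion_lt_of_countable hκ hω fun n => mk_iUnion_lt_of_countable hκ hω fun m => ?_
    exact mk_image_le.trans_lt (mk_span_lt hω hR ((mk_slice_le _ n m).trans_lt hF))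
  obtain ⟨T, hST, hT, hcl, hTex⟩ := exists_small_exact hκ hω hA hex Φ hΦ (toY '' S)
    (mk_image_le.trans_lt hS)
  have hspan : ∀ n m x, x ∈ Submodule.span R (slice T n m) → x ∈ slice T n m := by
    intro n m x hx
    obtain ⟨F, hF, hxF⟩ := Submodule.mem_span_finite_of_mem_span hx
    have hinj : Function.Injective (fun y => (⟨n, m, y⟩ : Elements Y)) := fun _ _ h =>
      eq_of_heq (Sigma.mk.inj (eq_of_heq (Sigma.mk.inj h).2)).2
    refine hcl (F.map ⟨_, hinj⟩) (fun b hb => ?_) (Or.inl ?_)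
    · obtain ⟨y, hy, rfl⟩ := Finset.mem_map.1 hb
      exact hF hy
    · refine Set.mem_iUnion₂.2 ⟨n, m, x, Submodule.span_mono (fun y hy => ?_) hxF, rfl⟩
      exact Finset.mem_map.2 ⟨y, hy, rfl⟩
  have hclop : ∀ b ∈ T, op b ⊆ T := fun b hb c hc => by
    refine hcl {b} (by simpa using hb) (Or.inr ?_)
    exact Set.mem_iUnion.2 ⟨⟨b, by simp⟩, hc⟩
  let Q' := Q.preimage T hspan
    (fun n m m' x hx => hclop _ hx (Or.inl (Or.inl (Set.mem_iUnion.2 ⟨m', rfl⟩))))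
    (fun n n' m x hx => hclop _ hx (Or.inl (Or.inr (Set.mem_iUnion.2 ⟨n', rfl⟩))))
  have hmem : ∀ {n m : ℤ} {x : (P.X n).X m}, x ∈ Q'.carrier n m ↔
      qmk ⊤ Q x (mem_top _) ∈ slice T n m := Iff.rfl
  have hle : Q ≤ Q' := fun n m x hx => by
    rw [hmem, qmk_eq_zero.2 hx]
    exact hspan n m _ (zero_mem _)
  -- One lift per class is enough: any other differs from it by an element of `Q`, and `Q` is
  -- stable.
  have hst : Stable C Q' := fun n i j x hx => by
    have h1 : (C n).map i j (sec n i (qmk ⊤ Q x (mem_top _))) ∈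
        Finsupp.supported R R (Q'.carrier n j : Set _) := fun y hy =>
      hclop _ (hmem.1 hx) (Or.inr (Set.mem_iUnion.2 ⟨j, y, hy, rfl⟩))
    have h2 : x - sec n i (qmk ⊤ Q x (mem_top _)) ∈ Q.carrier n i := qmk_eq.1 (hsec n i _).symm
    have h3 := add_mem (Finsupp.supported_mono (hle n j) (hQ n i j _ h2)) h1
    rwa [← map_add, sub_add_cancel] at h3
  -- The image of `Q' / Q` in `P / Q` is exactly `T`. This transfers to `Q' / Q` both the exactness
  -- on `T` and the bound on its size.
  have hrange : ∀ n j, Set.range (((quotMap (le_refl Q) (le_top Q')).f n).f j).hom =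
      slice T n j := fun n j => by
    ext t
    constructor
    · rintro ⟨s, rfl⟩
      obtain ⟨x, hx, rfl⟩ := exists_qmk s
      exact hx
    · intro ht
      obtain ⟨x, hx, rfl⟩ := exists_qmk (Q := Q) (Q' := ⊤) t
      exact ⟨qmk Q' Q x ht, rfl⟩
  have hsplit := hst.isDegreewiseSplit hle (le_top Q') (stable_top (C := C))
  refine ⟨Q', hle, hst, fun b hb => hST ⟨b, hb, rfl⟩, ?_, ?_⟩
  · refine acyclic_of_injective (quotMap (le_refl Q) (le_top Q')) (hsplit.barMap_injective A) ?_
    intro n m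
    rw [range_barMap, range_barMap]
    simp only [hrange]
    exact hTex n m
  · have hinj : Function.Injective (Sigma.map id fun n => Sigma.map id fun m =>
        (((quotMap (le_refl Q) (le_top Q')).f n).f m).hom :
          Elements (Q'.quotient Q) → Elements Y) :=
      Function.injective_id.sigma_map fun n => Function.injective_id.sigma_map (hsplit.inj n)
    have hT' : ∀ b : Elements (Q'.quotient Q), (Sigma.map id fun n => Sigma.map id fun m =>
        (((quotMap (le_refl Q) (le_top Q')).f n).f m).hom :
          Elements (Q'.quotient Q) → Elements Y) b ∈ T := fun b =>
      (hrange b.1 b.2.1).le ⟨b.2.2, rfl⟩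
    exact (mk_le_of_injective (hinj.codRestrict hT')).trans_lt hT

end Subcomplex

end DoubleCx

namespace DoubleCx

open Cardinal

/-! ### Unions of chains and transfinite iteration -/

namespace Subcomplex

variable {R : Type u} [Ring R] {A : ChainComplex (ModuleCat.{u} Rᵐᵒᵖ) ℤ} {κ : Cardinal.{u}}
  {P : DoubleComplex R} {C : ∀ n, FreeContraction (P.X n)} {Q Q' : Subcomplex P}

/-- The supremum of a family of subcomplexes. -/
def sup {ι : Sort*} (Q : ι → Subcomplex P) : Subcomplex P where
  carrier n m := ⨆ k, (Q k).carrier n m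
  inner_mem n m m' := iSup_le fun k => ((Q k).inner_mem n m m').trans
    (Submodule.comap_mono (le_iSup (fun k => (Q k).carrier n m') k))
  outer_mem n n' m := iSup_le fun k => ((Q k).outer_mem n n' m).trans
    (Submodule.comap_mono (le_iSup (fun k => (Q k).carrier n' m) k))

theorem le_sup {ι : Sort*} (Q : ι → Subcomplex P) (k : ι) : Q k ≤ sup Q := fun n m =>
  le_iSup (fun k => (Q k).carrier n m) k

section Chain

variable {ι : Type*} [LinearOrder ι] [Nonempty ι] {Q : ι → Subcomplex P}

theorem mem_sup (hQ : ∀ k l, k ≤ l → Q k ≤ Q l) {n m : ℤ} {x : (P.X n).X m} :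
    x ∈ (sup Q).carrier n m ↔ ∃ k, x ∈ (Q k).carrier n m :=
  Submodule.mem_iSup_of_directed _
    (Monotone.directed_le (f := fun k => (Q k).carrier n m) fun k l h => hQ k l h n m)

theorem stable_sup (hQ : ∀ k l, k ≤ l → Q k ≤ Q l) (h : ∀ k, Stable C (Q k)) :
    Stable C (sup Q) := fun n i j x hx => by
  obtain ⟨k, hk⟩ := (mem_sup hQ).1 hx
  exact Finsupp.supported_mono (le_sup Q k n j) (h k n i j x hk)

/-- A class in the tensor product is a finite sum of pure tensors, so it comes from a single member
of the chain; stability makes the comparison maps injective. -/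
theorem acyclic_sup (hQ : ∀ k l, k ≤ l → Q k ≤ Q l) (h : ∀ k, Stable C (Q k))
    (hA : ∀ k, (tensorDouble A ((Q k).quotient ⊥)).Acyclic) :
    (tensorDouble A ((sup Q).quotient ⊥)).Acyclic := by
  refine acyclic_of_exhausted (fun k => quotMap (le_refl ⊥) (le_sup Q k)) (fun k =>
    ((h k).isDegreewiseSplit (bot_le _) (le_sup Q k) (stable_sup hQ h)).barMap_injective A) hA ?_
  intro n m t
  simp only [range_barMap]
  have mono : ∀ k l, k ≤ l → barSpan A (((sup Q).quotient ⊥).X n) m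
      (fun j => Set.range (((quotMap (le_refl ⊥) (le_sup Q k)).f n).f j).hom) ≤
      barSpan A (((sup Q).quotient ⊥).X n) m
      (fun j => Set.range (((quotMap (le_refl ⊥) (le_sup Q l)).f n).f j).hom) := by
    refine fun k l hkl => barSpan_mono fun j => ?_
    rintro _ ⟨y, rfl⟩
    obtain ⟨x, hx, rfl⟩ := exists_qmk y
    exact ⟨qmk (Q l) ⊥ x (hQ k l hkl n j hx), rfl⟩
  have ht : t ∈ barSpan A (((sup Q).quotient ⊥).X n) m (fun _ => Set.univ) := by
    rw [barSpan_univ]; trivial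
  induction ht using AddSubgroup.closure_induction with
  | mem t ht =>
    obtain ⟨i, j, hij, a, y, -, rfl⟩ := ht
    obtain ⟨x, hx, rfl⟩ := exists_qmk y
    obtain ⟨k, hk⟩ := (mem_sup hQ).1 hx
    exact ⟨k, AddSubgroup.subset_closure ⟨i, j, hij, a, _, ⟨qmk (Q k) ⊥ x hk, rfl⟩, rfl⟩⟩
  | zero => exact ⟨Classical.arbitrary ι, zero_mem _⟩
  | add t u _ _ ht hu =>
    obtain ⟨k, hk⟩ := ht
    obtain ⟨l, hl⟩ := hu
    exact ⟨max k l, add_mem (mono _ _ (le_max_left k l) hk) (mono _ _ (le_max_right k l) hl)⟩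
  | neg t _ ht =>
    obtain ⟨k, hk⟩ := ht
    exact ⟨k, neg_mem hk⟩

end Chain

variable (A C) in
/-- A stable subcomplex on which `A ⊗̄ -` is exact. -/
def Good (Q : Subcomplex P) : Prop := Stable C Q ∧ (tensorDouble A (Q.quotient ⊥)).Acyclic

theorem Good.isAcyclicOfProjectives (h : Good A C Q) : IsAcyclicOfProjectives A Q.toDouble := by
  have := isIso_of_bijective Q.toQuotientBot Q.toQuotientBot_bijective
  exact .of_iso (asIso Q.toQuotientBot).symm ⟨stable_bot.projective_quotient h.1, h.2⟩

theorem good_bot : Good A C (⊥ : Subcomplex P) := by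
  refine ⟨stable_bot, (acyclic_tensorDouble_iff _).2 fun n m t _ => ⟨0, ?_⟩⟩
  have ht : t ∈ barSpan A (((⊥ : Subcomplex P).quotient ⊥).X (n + 1)) m (fun _ => Set.univ) := by
    rw [barSpan_univ]; trivial
  rw [map_zero, eq_comm]
  refine (AddSubgroup.closure_le (K := ⊥)).2 ?_ ht
  rintro _ ⟨i, j, h, a, y, -, rfl⟩
  obtain ⟨x, hx, rfl⟩ := exists_qmk y
  refine AddSubgroup.mem_bot.2 ?_
  rw [qmk_eq_zero.2 hx, barPure, btmul_zero, map_zero]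
  rfl

theorem acyclic_top (hP : (tensorDouble A P).Acyclic) :
    (tensorDouble A ((⊤ : Subcomplex P).quotient ⊥)).Acyclic := fun n => by
  have := isIso_of_bijective (toTopQuotientBot P) (toTopQuotientBot_bijective P)
  exact (hP n).of_iso
    (((barTensor A).mapHomologicalComplex (ComplexShape.down ℤ)).mapIso
      (asIso (toTopQuotientBot P)))

/-- Exactness passes from `Q` and `P` to `P / Q`, which permits the enlargement, and then from `Q`
and `Q' / Q` to `Q'`, so the construction can continue. -/
theorem Good.exists_step (hκ : κ.IsRegular) (hω : ℵ₀ < κ) (hR : #R < κ) (hA : card A < κ)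
    (hP : (tensorDouble A P).Acyclic) (hQ : Good A C Q) (S : Set (Elements P)) (hS : #S < κ) :
    ∃ Q' : Subcomplex P, Q ≤ Q' ∧ Good A C Q' ∧ (∀ b ∈ S, b.2.2 ∈ Q'.carrier b.1 b.2.1) ∧
      IsAcyclicOfProjectives A (Q'.quotient Q) ∧ cardDouble (Q'.quotient Q) < κ := by
  have hex : (tensorDouble A ((⊤ : Subcomplex P).quotient Q)).Acyclic :=
    (hQ.1.isDegreewiseSplit (bot_le Q) (le_top Q) stable_top).acyclic₃ hQ.2 (acyclic_top hP)
  obtain ⟨Q', hle, hst, hSQ, hac, hcard⟩ := hQ.1.exists_step hκ hω hR hA hex S hS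
  exact ⟨Q', hle, ⟨hst, (hQ.1.isDegreewiseSplit (bot_le Q) hle hst).acyclic₂ hQ.2 hac⟩, hSQ,
    ⟨hQ.1.projective_quotient hst, hac⟩, hcard⟩

/-- The set of elements of a subcomplex. -/
def elements (Q : Subcomplex P) : Set (Elements P) := {b | b.2.2 ∈ Q.carrier b.1 b.2.1}

theorem cardDouble_toDouble_le (Q : Subcomplex P) : cardDouble Q.toDouble ≤ #Q.elements := by
  have hinj : Function.Injective (Sigma.map id fun n => Sigma.map id fun m =>
      (Q.carrier n m).subtype : Elements Q.toDouble → Elements P) :=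
    Function.injective_id.sigma_map fun n => Function.injective_id.sigma_map fun m =>
      Subtype.val_injective
  refine mk_le_of_injective (hinj.codRestrict (s := Q.elements) fun b => ?_)
  obtain ⟨n, m, x⟩ := b
  exact Subtype.prop (p := (· ∈ Q.carrier n m)) x

/-- The zero subcomplex is not empty: it contributes one zero for every bidegree, countably many in
all. -/
theorem mk_elements_bot_lt (hω : ℵ₀ < κ) : #(⊥ : Subcomplex P).elements < κ := by
  refine lt_of_le_of_lt ?_ hω
  have : (⊥ : Subcomplex P).elements ⊆ Set.range fun p : ℤ × ℤ => (⟨p.1, p.2, 0⟩ : Elements P) := by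
    rintro ⟨n, m, x⟩ hx
    obtain rfl : x = 0 := hx
    exact ⟨(n, m), rfl⟩
  exact ((Set.countable_range _).mono this).le_aleph0

/-- Each element of `Q'` is a chosen representative of its class plus an element of `Q`. -/
theorem mk_elements_lt_of_quotient (hκ : κ.IsRegular) (hω : ℵ₀ < κ) (hQ : #Q.elements < κ)
    (h : cardDouble (Q'.quotient Q) < κ) : #Q'.elements < κ := by
  have hsub : Q'.elements ⊆ ⋃ c : Elements (Q'.quotient Q), ⋃ b : Q.elements,
      {e | ∃ y, b.1 = ⟨c.1, c.2.1, y⟩ ∧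
        e = ⟨c.1, c.2.1, (exists_qmk c.2.2).choose + y⟩} := by
    rintro ⟨n, m, x⟩ hx
    let c : ((Q'.quotient Q).X n).X m := qmk Q' Q x hx
    have hc := (exists_qmk c).choose_spec.choose_spec
    refine Set.mem_iUnion₂.2 ⟨⟨n, m, c⟩, ⟨⟨n, m, x - (exists_qmk c).choose⟩,
      qmk_eq.1 hc.symm⟩, _, rfl, ?_⟩
    change _ = (⟨n, m, (exists_qmk c).choose + (x - (exists_qmk c).choose)⟩ : Elements P)
    rw [add_sub_cancel]
  refine (mk_le_mk_of_subset hsub).trans_lt (mk_iUnion_lt_of_isRegular hκ h fun c =>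
    mk_iUnion_lt_of_isRegular hκ hQ fun b => ?_)
  refine (mk_le_one_iff_set_subsingleton.2 ?_).trans_lt (one_lt_aleph0.trans hω)
  rintro _ ⟨y, hb, rfl⟩ _ ⟨y', hb', rfl⟩
  rw [hb] at hb'
  cases hb'
  rfl

/-- The transfinite iteration of an operation on subcomplexes, starting at `0` and taking suprema at
limits. -/
noncomputable def iterate (next : Ordinal.{u} → Subcomplex P → Subcomplex P) (α : Ordinal.{u}) :
    Subcomplex P :=
  Ordinal.limitRecOn α ⊥ next fun γ _ ih => sup fun β : Set.Iio γ => ih β.1 β.2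

section Iterate

variable (next : Ordinal.{u} → Subcomplex P → Subcomplex P)

theorem iterate_zero : iterate next 0 = ⊥ := Ordinal.limitRecOn_zero ..

theorem iterate_add_one (α : Ordinal.{u}) : iterate next (α + 1) = next α (iterate next α) :=
  Ordinal.limitRecOn_add_one ..

theorem iterate_limit {γ : Ordinal.{u}} (hγ : Order.IsSuccLimit γ) :
    iterate next γ = sup fun β : Set.Iio γ => iterate next β :=
  Ordinal.limitRecOn_limit _ _ _ _ hγ

theorem iterate_mono (h : ∀ α Q, Q ≤ next α Q) {α β : Ordinal.{u}} (hαβ : α ≤ β) :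
    iterate next α ≤ iterate next β := by
  induction β using Ordinal.limitRecOn with
  | zero => obtain rfl := nonpos_iff_eq_zero.1 hαβ; exact le_refl _
  | add_one β ih =>
    obtain rfl | hlt := hαβ.eq_or_lt
    · exact le_refl _
    · rw [iterate_add_one next β]
      exact fun n m => (ih (Order.lt_add_one_iff.1 hlt) n m).trans (h β _ n m)
  | limit γ hγ ih =>
    obtain rfl | hlt := hαβ.eq_or_lt
    · exact le_refl _
    · rw [iterate_limit next hγ]
      exact le_sup (fun β : Set.Iio γ => iterate next β) ⟨α, hlt⟩

theorem mem_iterate_limit (h : ∀ α Q, Q ≤ next α Q) {γ : Ordinal.{u}} (hγ : Order.IsSuccLimit γ)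
    {n m : ℤ} {x : (P.X n).X m} : x ∈ (iterate next γ).carrier n m ↔
      ∃ α < γ, x ∈ (iterate next α).carrier n m := by
  have : Nonempty (Set.Iio γ) := ⟨⟨0, hγ.bot_lt⟩⟩
  rw [iterate_limit next hγ,
    mem_sup (Q := fun k : Set.Iio γ => iterate next k) fun k l hkl => iterate_mono next h hkl]
  simp

theorem good_iterate (h : ∀ α Q, Q ≤ next α Q) (hgood : ∀ α Q, Good A C Q → Good A C (next α Q))
    (α : Ordinal.{u}) : Good A C (iterate next α) := by
  induction α using Ordinal.limitRecOn with
  | zero => rw [iterate_zero]; exact good_bot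
  | add_one α ih => rw [iterate_add_one]; exact hgood α _ ih
  | limit γ hγ ih =>
    have : Nonempty (Set.Iio γ) := ⟨⟨0, hγ.bot_lt⟩⟩
    have hm : ∀ k l : Set.Iio γ, k ≤ l → iterate next k ≤ iterate next l :=
      fun k l hkl => iterate_mono next h hkl
    rw [iterate_limit next hγ]
    exact ⟨stable_sup hm fun k => (ih k.1 k.2).1,
      acyclic_sup hm (fun k => (ih k.1 k.2).1) fun k => (ih k.1 k.2).2⟩

/-- A successor stage adds a small quotient. A limit stage below `κ.ord` is a union of fewer than
`κ` small sets, hence small by regularity. -/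
theorem mk_elements_iterate_lt (hκ : κ.IsRegular) (hω : ℵ₀ < κ) (h : ∀ α Q, Q ≤ next α Q)
    (hcard : ∀ α, cardDouble ((iterate next (α + 1)).quotient (iterate next α)) < κ)
    {α : Ordinal.{u}} (hα : α < κ.ord) : #(iterate next α).elements < κ := by
  induction α using Ordinal.limitRecOn with
  | zero => rw [iterate_zero]; exact mk_elements_bot_lt hω
  | add_one α ih =>
    exact mk_elements_lt_of_quotient hκ hω (ih ((lt_add_one α).trans hα)) (hcard α)
  | limit γ hγ ih =>
    have hsub : (iterate next γ).elements ⊆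
        ⋃ k : γ.ToType, (iterate next (Ordinal.ToType.toOrd k)).elements := fun b hb => by
      obtain ⟨β, hβ, hb⟩ := (mem_iterate_limit next h hγ).1 hb
      refine Set.mem_iUnion.2 ⟨Ordinal.ToType.mk ⟨β, hβ⟩, ?_⟩
      simpa [elements] using hb
    refine (mk_le_mk_of_subset hsub).trans_lt (mk_iUnion_lt_of_isRegular hκ ?_ fun k => ?_)
    · rw [mk_toType]; exact lt_ord.1 hα
    · exact ih _ (Ordinal.ToType.toOrd k).2 (lt_trans (Ordinal.ToType.toOrd k).2 hα)

end Iterate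

end Subcomplex

end DoubleCx

/-! ### Construction of the filtration -/

open DoubleCx DoubleCx.Subcomplex in
theorem theorem3p6 {R : Type u} [Ring R] (A : ChainComplex (ModuleCat.{u} Rᵐᵒᵖ) ℤ)
    (κ : Cardinal.{u}) (hκ : κ.IsRegular) (hκω : Cardinal.aleph0 < κ)
    (hκR : Cardinal.mk R < κ) (hκA : DoubleCx.card A < κ)
    (P : DoubleCx.DoubleComplex R) (hP0 : ¬ Limits.IsZero P)
    (hP : DoubleCx.IsAcyclicOfProjectives A P) :
    ∃ (lam : Ordinal.{u}) (Q : Ordinal.{u} → DoubleCx.Subcomplex P),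
      DoubleCx.Subcomplex.IsContinuousUnion lam Q ∧
      (∀ α, α < lam → DoubleCx.IsAcyclicOfProjectives A (Q α).toDouble) ∧
      (∀ α, α + 1 < lam →
        DoubleCx.IsAcyclicOfProjectives A ((Q (α + 1)).quotient (Q α)) ∧
        DoubleCx.cardDouble ((Q (α + 1)).quotient (Q α)) < κ) ∧
      (∀ α, α < lam → α < κ.ord → DoubleCx.cardDouble (Q α).toDouble < κ) := by
  classical
  have := hP.projective
  let C : ∀ n, FreeContraction (P.X n) := fun n => (exists_freeContraction (P.X n)).some
  -- A well-order of the elements of `P` whose order type is the initial ordinal of their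
  -- cardinality; this ordinal will be `lam`.
  obtain ⟨r, _, hr⟩ := Cardinal.exists_ord_eq (Elements P)
  -- Stage `α` is asked to absorb only the element of rank `α`, if there is one.
  have hS : ∀ α : Ordinal.{u}, Cardinal.mk {b | Ordinal.typein r b = α} < κ := fun α => by
    refine (Cardinal.mk_le_one_iff_set_subsingleton.2 fun b hb b' hb' => ?_).trans_lt
      (Cardinal.one_lt_aleph0.trans hκω)
    exact Ordinal.typein_injective r (Eq.trans hb (Eq.symm hb'))
  have step := fun (α : Ordinal.{u}) (Q : Subcomplex P) (hQ : Good A C Q) =>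
    hQ.exists_step hκ hκω hκR hκA hP.exact _ (hS α)
  -- Returning `Q` when it is not good makes `next` total and increasing; by `hgood` this case never
  -- arises along the iteration.
  let next : Ordinal.{u} → Subcomplex P → Subcomplex P := fun α Q =>
    if hQ : Good A C Q then (step α Q hQ).choose else Q
  have hnext : ∀ α Q, Q ≤ next α Q := fun α Q => by
    by_cases hQ : Good A C Q
    · simp only [next, dif_pos hQ]; exact (step α Q hQ).choose_spec.1
    · simp only [next, dif_neg hQ]; exact le_refl Q
  have hspec : ∀ α Q, Good A C Q → Good A C (next α Q) ∧
      (∀ b, Ordinal.typein r b = α → b.2.2 ∈ (next α Q).carrier b.1 b.2.1) ∧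
      IsAcyclicOfProjectives A ((next α Q).quotient Q) ∧
      cardDouble ((next α Q).quotient Q) < κ := fun α Q hQ => by
    simp only [next, dif_pos hQ]
    exact (step α Q hQ).choose_spec.2
  have hgood : ∀ α, Good A C (iterate next α) :=
    good_iterate next hnext fun α Q hQ => (hspec α Q hQ).1
  have hquot : ∀ α, IsAcyclicOfProjectives A ((iterate next (α + 1)).quotient (iterate next α)) ∧
      cardDouble ((iterate next (α + 1)).quotient (iterate next α)) < κ := fun α => by
    rw [iterate_add_one]
    exact (hspec α _ (hgood α)).2.2
  -- The element of rank `ρ` is absorbed only at stage `ρ + 1`, so `lam` must be a limit. It is one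
  -- because the zeros in the various degrees make the set of elements infinite.
  have hlim : Order.IsSuccLimit (Cardinal.mk (Elements P)).ord := by
    have : Infinite (Elements P) := Infinite.of_injective
      (fun n : ℤ => (⟨n, 0, 0⟩ : Elements P)) fun _ _ h => (Sigma.mk.inj h).1
    exact Cardinal.isSuccLimit_ord (Cardinal.aleph0_le_mk _)
  refine ⟨(Cardinal.mk (Elements P)).ord, iterate next, ⟨?_, ?_, ?_⟩, ?_, ?_, ?_⟩
  · exact fun α β h _ => iterate_mono next hnext h
  · exact fun γ _ hγ n m x => mem_iterate_limit next hnext hγ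
  · intro n m x
    refine ⟨Ordinal.typein r ⟨n, m, x⟩ + 1, hlim.add_one_lt ?_, ?_⟩
    · rw [hr]; exact Ordinal.typein_lt_type r _
    · rw [iterate_add_one]
      exact (hspec _ _ (hgood _)).2.1 ⟨n, m, x⟩ rfl
  · exact fun α _ => (hgood α).isAcyclicOfProjectives
  · exact fun α _ => hquot α
  · exact fun α _ hα => (cardDouble_toDouble_le _).trans_lt
      (mk_elements_iterate_lt next hκ hκω hnext (fun α => (hquot α).2) hα)
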